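/- Let $N\ge 1$. For $\mathbf U$ in the group $\mathbb U(N)$ of $N\times N$ unitary matrices, with eigenvalues $e^{i\theta_1},\dots,e^{i\theta_N}$, $\theta_j\in[0,2\pi)$, put $$Z_{\mathbf U}(\theta)=\det(\mathbf I-e^{-i\theta}\mathbf U),\qquad V_{\mathbf U}(\theta)=e^{iN\frac{\theta+\pi}{2}-i\sum_{j=1}^N\frac{\theta_j}{2}}Z_{\mathbf U}(\theta),$$ and, with $\mu_N$ the Haar probability measure on $\mathbb U(N)$, $$\mathfrak F_N(s,h)=\int_{\mathbb U(N)}|V_{\mathbf U}(0)|^{2s-2h}\,|V'_{\mathbf U}(0)|^{2h}\,d\mu_N(\mathbf U).$$ For $s>-\tfrac12$ let $\mathsf M_N^{(s)}$ be the Hua–Pickrell probability measure on $\mathbb W_N=\{\mathbf x\in\mathbb R^N: x_1\ge x_2\ge\cdots\ge x_N\}$, $$\mathsf M_N^{(s)}(d\mathbf x)=\frac1{\mathsf c_N^{(s)}}\prod_{j=1}^N\frac1{(1+x_j^2)^{N+s}}\prod_{1\le i<j\le N}(x_j-x_i)^2\,dx_1\cdots dx_N,$$ $$\mathsf c_N^{(s)}=(2\pi)^N2^{-N^2-2sN}\,G(N+1)\prod_{j=1}^N\frac{\Gamma(2s+N-j+1)}{\Gamma(s+N-j+1)^2},$$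 where $G$ is the Barnes $G$-function, so $G(N+1)=\prod_{k=0}^{N-1}k!$, and let $\mathbb E_N^{(s)}$ denote the expectation with respect to $\mathsf M_N^{(s)}$. Then for all real $s>-\tfrac12$ and $-\tfrac12<h<s+\tfrac12$, the measure $\mathsf M_N^{(s)}$ has total mass one, the integral $\mathfrak F_N(s,h)$ and the expectation below are finite, and $$\mathfrak F_N(s,h)=\mathfrak F_N(s,0)\,2^{-2h}\,\mathbb E_N^{(s)}\left[\left|\sum_{i=1}^N x_i\right|^{2h}\right].$$ -/

import Mathlib

open scoped BigOperators

noncomputable section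

namespace JointMoments

open MeasureTheory Matrix

/-- `𝕌(N)`, the group of `N × N` complex unitary matrices. -/
abbrev U (N : ℕ) : Type := Matrix.unitaryGroup (Fin N) ℂ

/-- The Borel σ-algebra on `𝕌(N)`. -/
instance instMeasurableSpaceU (N : ℕ) : MeasurableSpace (U N) := borel (U N)

instance instBorelSpaceU (N : ℕ) : BorelSpace (U N) := ⟨rfl⟩

instance instCompactSpaceU (N : ℕ) : CompactSpace (U N) := by
  have hcl : IsClosed {A : Matrix (Fin N) (Fin N) ℂ | A ∈ Matrix.unitaryGroup (Fin N) ℂ} := by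
    have h : {A : Matrix (Fin N) (Fin N) ℂ | A ∈ Matrix.unitaryGroup (Fin N) ℂ}
        = {A | A * star A = 1} := by
      ext A
      exact Matrix.mem_unitaryGroup_iff
    rw [h]
    exact isClosed_eq (continuous_id.mul continuous_star) continuous_const
  have hK : IsCompact (Set.univ.pi fun _ : Fin N => Set.univ.pi fun _ : Fin N =>
      Metric.closedBall (0 : ℂ) 1) :=
    isCompact_univ_pi fun _ => isCompact_univ_pi fun _ => isCompact_closedBall 0 1
  have hc : IsCompact {A : Matrix (Fin N) (Fin N) ℂ | A ∈ Matrix.unitaryGroup (Fin N) ℂ} := by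
    refine IsCompact.of_isClosed_subset hK hcl ?_
    intro A hA i _ j _
    rw [mem_closedBall_zero_iff]
    exact entry_norm_bound_of_unitary hA i j
  exact isCompact_iff_compactSpace.mp hc

/-- The Haar probability measure `μ_N` on `𝕌(N)` (the Haar measure giving mass one to the whole
compact group). -/
def haarU (N : ℕ) : Measure (U N) := Measure.haarMeasure ⊤

/-- The multiset of eigenangles `θ₁, …, θ_N ∈ [0, 2π)` of `A`: the eigenvalues, counted with
algebraic multiplicity, are `exp (i θ_j)`. -/
def eigenangles {N : ℕ} (A : U N) : Multiset ℝ :=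
  (A : Matrix (Fin N) (Fin N) ℂ).charpoly.roots.map
    fun z => toIcoMod Real.two_pi_pos 0 (Complex.arg z)

/-- The characteristic polynomial `Z_A(θ) = det (I - e^{-iθ} A)`. -/
def Z {N : ℕ} (A : U N) (θ : ℝ) : ℂ :=
  (1 - Complex.exp (-Complex.I * θ) • (A : Matrix (Fin N) (Fin N) ℂ)).det

/-- `V_A(θ) = exp (i N (θ + π) / 2 - i ∑ θ_j / 2) Z_A(θ)`. -/
def V {N : ℕ} (A : U N) (θ : ℝ) : ℂ :=
  Complex.exp (Complex.I * N * ((θ + Real.pi) / 2)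
    - Complex.I * (((eigenangles A).sum : ℝ) / 2)) * Z A θ

/-- The integrand `|V_A(0)|^{2s-2h} |V_A'(0)|^{2h}`. -/
def jointIntegrand (N : ℕ) (s h : ℝ) (A : U N) : ℝ :=
  ‖V A 0‖ ^ (2 * s - 2 * h) * ‖deriv (V A) 0‖ ^ (2 * h)

/-- The joint moments `𝔉_N(s, h)`. -/
def jointMoment (N : ℕ) (s h : ℝ) : ℝ :=
  ∫ A, jointIntegrand N s h A ∂(haarU N)

/-- The Weyl chamber `x₁ ≥ x₂ ≥ ⋯ ≥ x_N`. -/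
def weylChamber (N : ℕ) : Set (Fin N → ℝ) := {x | Antitone x}

/-- The Vandermonde determinant `∏_{i < j} (x_j - x_i)`. -/
def vandermonde {N : ℕ} (x : Fin N → ℝ) : ℝ :=
  ∏ i : Fin N, ∏ j ∈ Finset.Ioi i, (x j - x i)

/-- The value `G(n + 1) = 0! 1! ⋯ (n-1)!` of the Barnes G-function at a positive integer,
i.e. the sequence determined by `G(1) = 1`, `G(z + 1) = Γ(z) G(z)`. -/
def barnesGSucc (n : ℕ) : ℝ := ∏ k ∈ Finset.range n, (k.factorial : ℝ)

/-- The normalization constant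
`(2π)^N 2^{-N² - 2sN} G(N+1) ∏_{j=1}^N Γ(2s + N - j + 1) / Γ(s + N - j + 1)²`. -/
def huaPickrellConst (N : ℕ) (s : ℝ) : ℝ :=
  (2 * Real.pi) ^ N * (2 : ℝ) ^ (-(N : ℝ) ^ 2 - 2 * s * N) * barnesGSucc N *
    ∏ j ∈ Finset.Icc 1 N,
      Real.Gamma (2 * s + N - j + 1) / Real.Gamma (s + N - j + 1) ^ 2

/-- The Hua–Pickrell measure `M_N^{(s)}`, carried by the Weyl chamber. -/
def huaPickrell (N : ℕ) (s : ℝ) : Measure (Fin N → ℝ) :=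
  (volume.restrict (weylChamber N)).withDensity fun x =>
    ENNReal.ofReal (1 / huaPickrellConst N s *
      (∏ j, 1 / (1 + x j ^ 2) ^ ((N : ℝ) + s)) * vandermonde x ^ 2)

end JointMoments

end

/-!
The integrand `|V(0)|^{2s-2h} |V'(0)|^{2h}` depends only on the eigenvalues, so the Haar integral
can be moved to the torus of eigenangles by Weyl's integration formula. In the Cayley coordinates
`e^{iθ_j} = (x_j + i) / (x_j - i)`, that is `x_j = cot (θ_j / 2)`, one has
`|V(0)| = ∏ 2 (1 + x_j²)^{-1/2}` and `V'(0) / V(0) = -(∑ x_j) / 2`; the measure `∏ dθ_j` becomes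
`∏ 2 (1 + x_j²)^{-1} dx_j`, and `∏ |e^{iθ_a} - e^{iθ_b}|²` becomes a constant times
`∏ (x_a - x_b)² ∏ (1 + x_j²)^{1-N}`. The product of these is the Hua–Pickrell density times
`2^{-2h} |∑ x_j|^{2h}`, with a constant that does not depend on `h`
(`weylMeasure_mul_lintegral_jointIntegrand`). Comparison with `h = 0`, where the expectation is `1`,
removes the constant (`lintegral_jointIntegrand`).

Weyl's formula is needed only up to a constant (`lintegral_haarU_of_conj_invariant`). Let
`A = V diag(e^{iθ}) V*`, where `V` is Haar distributed and `θ` is distributed according to the Weyl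
density. The law of `A` is shown to be left invariant, hence a multiple of Haar measure: the
derivative of a function of `A` under an infinitesimal left translation, multiplied by the Weyl
density, is a divergence in `(V, θ)` (`weylDensity_mul_leftDeriv`), so its integral vanishes. It is
enough to test this on exponentials of linear functionals, which determine a finite measure, and to
use translations by `exp (i t H)`, which generate `𝕌(N)`.

The total mass of the Hua–Pickrell measure comes from Andréief's identity
(`integral_det_mul_det`): the density is a product of two determinants, so its integral over `ℝ^N`
is `N!` times the determinant of the one-dimensional integrals
`∫ (1 + x²)^{-(s+1)} (x + i)^{-k} (x - i)^{-l} dx`, which have a closed form in Gamma functions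
(`cauchyBeta_eq`), and by symmetry each of the `N!` chambers carries the same share.

For finiteness, the density is at most `∏ (1 + x_j²)^{-(s+1)}`. If `h ≥ 0`, then
`|∑ x_j|² ≤ ∏ 2 (1 + x_j²)`, which leaves an integrable product because `h < s + 1/2`. If `h < 0`,
integration over a single coordinate bounds the contribution of the singularity uniformly in the
other coordinates, because `2h > -1`.
-/

open scoped BigOperators

noncomputable section

namespace JointMoments

open MeasureTheory Matrix

open scoped Matrix.Norms.L2Operator

open scoped Real ENNReal

/-! ### Integration by parts along measure-preserving flows -/

/-- Integration by parts without boundary: the derivative of a function along a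
measure-preserving flow has mean zero. -/
theorem integral_deriv_flow_eq_zero {α : Type*} [MeasurableSpace α] {μ : Measure α}
    [IsFiniteMeasure μ] (φ : ℝ → α → α) (hφ : ∀ t, MeasurePreserving (φ t) μ μ)
    (hφ0 : ∀ a, φ 0 a = a) {Φ Ψ : α → ℂ} (hΦ : Integrable Φ μ)
    (hΨm : AEStronglyMeasurable Ψ μ) {C : ℝ} (hC : ∀ a, ‖Ψ a‖ ≤ C)
    (hd : ∀ a t, HasDerivAt (fun t => Φ (φ t a)) (Ψ (φ t a)) t) : ∫ a, Ψ a ∂μ = 0 := by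
  have key := hasDerivAt_integral_of_dominated_loc_of_deriv_le (μ := μ) (x₀ := (0 : ℝ))
    (F := fun t a => Φ (φ t a)) (F' := fun t a => Ψ (φ t a)) (bound := fun _ => C)
    (s := Set.univ) Filter.univ_mem
    (Filter.Eventually.of_forall fun t => ((hφ t).integrable_comp_of_integrable hΦ).1)
    ((hφ 0).integrable_comp_of_integrable hΦ)
    (hΨm.comp_measurePreserving (hφ 0)) (Filter.Eventually.of_forall fun a t _ => hC _)
    (integrable_const C) (Filter.Eventually.of_forall fun a t _ => hd a t)
  have hconst : (fun t => ∫ a, Φ (φ t a) ∂μ) = fun _ => ∫ a, Φ a ∂μ := by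
    funext t
    have h := (hφ t).map_eq
    conv_rhs => rw [← h]
    rw [integral_map (hφ t).aemeasurable]
    rw [h]; exact hΦ.1
  have h2 := key.2
  rw [hconst] at h2
  have := h2.unique (hasDerivAt_const (0 : ℝ) _)
  simpa [hφ0] using this

theorem integral_deriv_flow_eq_zero_of_continuous {α : Type*} [TopologicalSpace α]
    [CompactSpace α] [MeasurableSpace α] [BorelSpace α] {μ : Measure α}
    [IsFiniteMeasure μ] (φ : ℝ → α → α) (hφ : ∀ t, MeasurePreserving (φ t) μ μ)
    (hφ0 : ∀ a, φ 0 a = a) {Φ Ψ : α → ℂ} (hΦ : Continuous Φ) (hΨ : Continuous Ψ)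
    (hd : ∀ a t, HasDerivAt (fun t => Φ (φ t a)) (Ψ (φ t a)) t) : ∫ a, Ψ a ∂μ = 0 := by
  obtain ⟨C, hC⟩ := isCompact_univ.exists_bound_of_continuousOn hΨ.continuousOn
  exact integral_deriv_flow_eq_zero φ hφ hφ0
    (hΦ.integrable_of_hasCompactSupport (HasCompactSupport.of_compactSpace Φ))
    (hΨ.integrable_of_hasCompactSupport (HasCompactSupport.of_compactSpace Ψ)).1
    (fun a => hC a trivial) hd

/-! ### Haar measure on the unitary group -/

instance instSecondCountableTopologyU (N : ℕ) : SecondCountableTopology (U N) :=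
  inferInstanceAs (SecondCountableTopology (Subtype _))

instance instIsHaarMeasureHaarU (N : ℕ) : (haarU N).IsHaarMeasure := by
  unfold haarU; infer_instance

instance instIsProbabilityMeasureHaarU (N : ℕ) : IsProbabilityMeasure (haarU N) :=
  ⟨by
    simpa [haarU] using Measure.haarMeasure_self
      (K₀ := (⊤ : TopologicalSpace.PositiveCompacts (U N)))⟩

/-- A left-invariant finite measure on `𝕌(N)` is a multiple of the Haar probability measure. -/
theorem eq_smul_haarU_of_isMulLeftInvariant {N : ℕ} (μ : Measure (U N)) [IsFiniteMeasure μ]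
    [μ.IsMulLeftInvariant] : μ = μ Set.univ • haarU N := by
  have h := Measure.isMulLeftInvariant_eq_smul μ (haarU N)
  have h1 : μ Set.univ = μ.haarScalarFactor (haarU N) := by
    conv_lhs => rw [h]
    rw [Measure.smul_apply, measure_univ, ENNReal.smul_def, smul_eq_mul, mul_one]
  rw [h1]; exact h

instance instIsMulRightInvariantHaarU (N : ℕ) : (haarU N).IsMulRightInvariant := by
  constructor
  intro g
  have : IsProbabilityMeasure ((haarU N).map (· * g)) :=
    Measure.isProbabilityMeasure_map (by fun_prop)
  have h := eq_smul_haarU_of_isMulLeftInvariant ((haarU N).map (· * g))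
  rwa [measure_univ, one_smul] at h

/-- The one-parameter subgroup `t ↦ exp (i t H)` of `𝕌(N)`. -/
def expFlow {N : ℕ} (H : selfAdjoint (Matrix (Fin N) (Fin N) ℂ)) (t : ℝ) : U N :=
  selfAdjoint.expUnitary (t • H)

theorem coe_expFlow {N : ℕ} (H : selfAdjoint (Matrix (Fin N) (Fin N) ℂ)) (t : ℝ) :
    (expFlow H t : Matrix (Fin N) (Fin N) ℂ)
      = NormedSpace.exp (t • (Complex.I • (H : Matrix (Fin N) (Fin N) ℂ))) := by
  simp only [expFlow, selfAdjoint.expUnitary_coe]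
  congr 1
  exact smul_comm Complex.I t (H : Matrix (Fin N) (Fin N) ℂ)

theorem expFlow_zero {N : ℕ} (H : selfAdjoint (Matrix (Fin N) (Fin N) ℂ)) :
    expFlow H 0 = 1 := by
  refine Subtype.ext ?_
  rw [coe_expFlow, zero_smul, NormedSpace.exp_zero]
  rfl

theorem hasDerivAt_expFlow {N : ℕ} (H : selfAdjoint (Matrix (Fin N) (Fin N) ℂ)) (t : ℝ) :
    HasDerivAt (fun t => (expFlow H t : Matrix (Fin N) (Fin N) ℂ))
      (expFlow H t * (Complex.I • (H : Matrix (Fin N) (Fin N) ℂ))) t := by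
  simp only [coe_expFlow]
  exact hasDerivAt_exp_smul_const (𝕂 := ℝ) _ t

theorem hasDerivAt_star_expFlow {N : ℕ} (H : selfAdjoint (Matrix (Fin N) (Fin N) ℂ)) (t : ℝ) :
    HasDerivAt (fun t => star (expFlow H t : Matrix (Fin N) (Fin N) ℂ))
      (-((Complex.I • (H : Matrix (Fin N) (Fin N) ℂ)) *
        star (expFlow H t : Matrix (Fin N) (Fin N) ℂ))) t := by
  have h := (hasDerivAt_expFlow H t).star
  have hH : star (H : Matrix (Fin N) (Fin N) ℂ) = H := H.2
  refine h.congr_deriv ?_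
  rw [star_mul, star_smul, hH]
  simp

/-! ### Derivatives along one-parameter subgroups -/

section Derivatives

variable {N : ℕ} (H : selfAdjoint (Matrix (Fin N) (Fin N) ℂ)) (V : U N)

theorem hasDerivAt_mul_expFlow (t : ℝ) :
    HasDerivAt (fun t => ((V * expFlow H t : U N) : Matrix (Fin N) (Fin N) ℂ))
      (((V * expFlow H t : U N) : Matrix (Fin N) (Fin N) ℂ) *
        (Complex.I • (H : Matrix (Fin N) (Fin N) ℂ))) t := by
  have h := (hasDerivAt_expFlow H t).const_mul (V : Matrix (Fin N) (Fin N) ℂ)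
  simpa only [Submonoid.coe_mul, mul_assoc] using h

theorem hasDerivAt_star_mul_expFlow (t : ℝ) :
    HasDerivAt (fun t => star ((V * expFlow H t : U N) : Matrix (Fin N) (Fin N) ℂ))
      (-((Complex.I • (H : Matrix (Fin N) (Fin N) ℂ)) *
        star ((V * expFlow H t : U N) : Matrix (Fin N) (Fin N) ℂ))) t := by
  have h := (hasDerivAt_star_expFlow H t).mul_const (star (V : Matrix (Fin N) (Fin N) ℂ))
  simpa only [Submonoid.coe_mul, star_mul, mul_assoc, neg_mul] using h

theorem hasDerivAt_conj_mul_expFlow (B : Matrix (Fin N) (Fin N) ℂ) (t : ℝ) :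
    HasDerivAt (fun t => ((V * expFlow H t : U N) : Matrix (Fin N) (Fin N) ℂ) * B *
        star ((V * expFlow H t : U N) : Matrix (Fin N) (Fin N) ℂ))
      (((V * expFlow H t : U N) : Matrix (Fin N) (Fin N) ℂ) *
        ((Complex.I • (H : Matrix (Fin N) (Fin N) ℂ)) * B
          - B * (Complex.I • (H : Matrix (Fin N) (Fin N) ℂ))) *
        star ((V * expFlow H t : U N) : Matrix (Fin N) (Fin N) ℂ)) t := by
  refine (((hasDerivAt_mul_expFlow H V t).mul_const B).mul
    (hasDerivAt_star_mul_expFlow H V t)).congr_deriv ?_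
  noncomm_ring

theorem hasDerivAt_star_conj_mul_expFlow (X : Matrix (Fin N) (Fin N) ℂ) (t : ℝ) :
    HasDerivAt (fun t => star ((V * expFlow H t : U N) : Matrix (Fin N) (Fin N) ℂ) * X *
        ((V * expFlow H t : U N) : Matrix (Fin N) (Fin N) ℂ))
      (star ((V * expFlow H t : U N) : Matrix (Fin N) (Fin N) ℂ) * X *
        ((V * expFlow H t : U N) : Matrix (Fin N) (Fin N) ℂ) *
          (Complex.I • (H : Matrix (Fin N) (Fin N) ℂ)) -
        (Complex.I • (H : Matrix (Fin N) (Fin N) ℂ)) *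
          (star ((V * expFlow H t : U N) : Matrix (Fin N) (Fin N) ℂ) * X *
        ((V * expFlow H t : U N) : Matrix (Fin N) (Fin N) ℂ))) t := by
  refine (((hasDerivAt_star_mul_expFlow H V t).mul_const X).mul
    (hasDerivAt_mul_expFlow H V t)).congr_deriv ?_
  noncomm_ring

end Derivatives

/-! ### Test functions on the unitary group -/

section TestFunctions

variable {N : ℕ} (ℓ₁ ℓ₂ : Matrix (Fin N) (Fin N) ℂ →L[ℂ] ℂ)

/-- The exponential of a linear functional in the conjugates of `B` and `B'` by `V`.
For `B` unitary and `B' = star B` these are the exponentials of linear functionals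
in the entries of `V B V*` and their conjugates. -/
def expConj (B B' : Matrix (Fin N) (Fin N) ℂ) (V : U N) : ℂ :=
  Complex.exp (ℓ₁ ((V : Matrix (Fin N) (Fin N) ℂ) * B * star (V : Matrix (Fin N) (Fin N) ℂ)) +
    ℓ₂ ((V : Matrix (Fin N) (Fin N) ℂ) * B' * star (V : Matrix (Fin N) (Fin N) ℂ)))

/-- The logarithmic derivative of `expConj` in the (complexified) right direction `M`. -/
def commDeriv (B B' : Matrix (Fin N) (Fin N) ℂ) (V : U N) (M : Matrix (Fin N) (Fin N) ℂ) : ℂ :=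
  ℓ₁ ((V : Matrix (Fin N) (Fin N) ℂ) * (M * B - B * M) * star (V : Matrix (Fin N) (Fin N) ℂ)) +
    ℓ₂ ((V : Matrix (Fin N) (Fin N) ℂ) * (M * B' - B' * M) * star (V : Matrix (Fin N) (Fin N) ℂ))

theorem continuous_expConj (B B' : Matrix (Fin N) (Fin N) ℂ) :
    Continuous (expConj ℓ₁ ℓ₂ B B') := by
  unfold expConj
  fun_prop

theorem continuous_commDeriv (B B' M : Matrix (Fin N) (Fin N) ℂ) :
    Continuous fun V => commDeriv ℓ₁ ℓ₂ B B' V M := by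
  unfold commDeriv
  fun_prop

theorem hasDerivAt_expConj (B B' : Matrix (Fin N) (Fin N) ℂ)
    (H : selfAdjoint (Matrix (Fin N) (Fin N) ℂ)) (V : U N) (t : ℝ) :
    HasDerivAt (fun t => expConj ℓ₁ ℓ₂ B B' (V * expFlow H t))
      (commDeriv ℓ₁ ℓ₂ B B' (V * expFlow H t) (Complex.I • (H : Matrix (Fin N) (Fin N) ℂ)) *
        expConj ℓ₁ ℓ₂ B B' (V * expFlow H t)) t := by
  have h1 := (ℓ₁.restrictScalars ℝ).hasFDerivAt.comp_hasDerivAt t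
    (hasDerivAt_conj_mul_expFlow H V B t)
  have h2 := (ℓ₂.restrictScalars ℝ).hasFDerivAt.comp_hasDerivAt t
    (hasDerivAt_conj_mul_expFlow H V B' t)
  have h3 := (h1.add h2).cexp
  refine h3.congr_deriv ?_
  simp only [commDeriv, expConj]
  rw [mul_comm]
  rfl

/-- Integration by parts on `𝕌(N)` against the function `V ↦ (V* X V)_{jk}`. The direction `M` may
be any complex matrix: for skew-Hermitian `M` the flow `V ↦ V exp (t M)` preserves Haar measure,
and both sides are complex linear in `M`. -/
theorem integral_haarU_by_parts (B B' X M : Matrix (Fin N) (Fin N) ℂ) (j k : Fin N) :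
    ∫ V : U N, ((star (V : Matrix (Fin N) (Fin N) ℂ) * X * V) j k * commDeriv ℓ₁ ℓ₂ B B' V M +
      ((star (V : Matrix (Fin N) (Fin N) ℂ) * X * V) * M -
        M * (star (V : Matrix (Fin N) (Fin N) ℂ) * X * V)) j k) * expConj ℓ₁ ℓ₂ B B' V
      ∂(haarU N) = 0 := by
  have hcont : ∀ M : Matrix (Fin N) (Fin N) ℂ, Continuous fun V : U N =>
      ((star (V : Matrix (Fin N) (Fin N) ℂ) * X * V) j k * commDeriv ℓ₁ ℓ₂ B B' V M +
      ((star (V : Matrix (Fin N) (Fin N) ℂ) * X * V) * M -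
        M * (star (V : Matrix (Fin N) (Fin N) ℂ) * X * V)) j k) * expConj ℓ₁ ℓ₂ B B' V := by
    intro M
    have := continuous_expConj ℓ₁ ℓ₂ B B'
    have := continuous_commDeriv ℓ₁ ℓ₂ B B' M
    fun_prop
  have hskew : ∀ H : selfAdjoint (Matrix (Fin N) (Fin N) ℂ),
      ∫ V : U N, ((star (V : Matrix (Fin N) (Fin N) ℂ) * X * V) j k *
        commDeriv ℓ₁ ℓ₂ B B' V (Complex.I • (H : Matrix (Fin N) (Fin N) ℂ)) +
      ((star (V : Matrix (Fin N) (Fin N) ℂ) * X * V) *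
        (Complex.I • (H : Matrix (Fin N) (Fin N) ℂ)) -
        (Complex.I • (H : Matrix (Fin N) (Fin N) ℂ)) *
          (star (V : Matrix (Fin N) (Fin N) ℂ) * X * V)) j k) * expConj ℓ₁ ℓ₂ B B' V
      ∂(haarU N) = 0 := by
    intro H
    refine integral_deriv_flow_eq_zero_of_continuous (fun t V => V * expFlow H t)
      (fun t => measurePreserving_mul_right _ _) (fun V => by rw [expFlow_zero, mul_one])
      (Φ := fun V => (star (V : Matrix (Fin N) (Fin N) ℂ) * X * V) j k * expConj ℓ₁ ℓ₂ B B' V)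
      ?_ (hcont _) ?_
    · have := continuous_expConj ℓ₁ ℓ₂ B B'
      fun_prop
    · intro V t
      have h1 := hasDerivAt_pi.1 (hasDerivAt_pi.1 (hasDerivAt_star_conj_mul_expFlow H V X t) j) k
      refine (h1.mul (hasDerivAt_expConj ℓ₁ ℓ₂ B B' H V t)).congr_deriv ?_
      ring
  have hM : M = Complex.I • ((imaginaryPart M : selfAdjoint _) : Matrix (Fin N) (Fin N) ℂ) +
      (-Complex.I) • (Complex.I • ((realPart M : selfAdjoint _) : Matrix (Fin N) (Fin N) ℂ)) := by
    conv_lhs => rw [← realPart_add_I_smul_imaginaryPart M]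
    rw [smul_smul, neg_mul, Complex.I_mul_I, neg_neg, one_smul, add_comm]
  set P := Complex.I • ((imaginaryPart M : selfAdjoint _) : Matrix (Fin N) (Fin N) ℂ) with hP
  set Q := Complex.I • ((realPart M : selfAdjoint _) : Matrix (Fin N) (Fin N) ℂ) with hQ
  have hlin : ∀ V : U N, ((star (V : Matrix (Fin N) (Fin N) ℂ) * X * V) j k *
        commDeriv ℓ₁ ℓ₂ B B' V M +
      ((star (V : Matrix (Fin N) (Fin N) ℂ) * X * V) * M -
        M * (star (V : Matrix (Fin N) (Fin N) ℂ) * X * V)) j k) * expConj ℓ₁ ℓ₂ B B' V =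
      ((star (V : Matrix (Fin N) (Fin N) ℂ) * X * V) j k * commDeriv ℓ₁ ℓ₂ B B' V P +
      ((star (V : Matrix (Fin N) (Fin N) ℂ) * X * V) * P -
        P * (star (V : Matrix (Fin N) (Fin N) ℂ) * X * V)) j k) * expConj ℓ₁ ℓ₂ B B' V +
      (-Complex.I) * (((star (V : Matrix (Fin N) (Fin N) ℂ) * X * V) j k *
        commDeriv ℓ₁ ℓ₂ B B' V Q +
      ((star (V : Matrix (Fin N) (Fin N) ℂ) * X * V) * Q -
        Q * (star (V : Matrix (Fin N) (Fin N) ℂ) * X * V)) j k) * expConj ℓ₁ ℓ₂ B B' V) := by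
    intro V
    have hc : commDeriv ℓ₁ ℓ₂ B B' V M =
        commDeriv ℓ₁ ℓ₂ B B' V P + (-Complex.I) * commDeriv ℓ₁ ℓ₂ B B' V Q := by
      rw [hM]
      simp only [commDeriv, add_mul, mul_add, smul_mul_assoc, mul_smul_comm, mul_sub, sub_mul,
        map_add, map_sub, map_smul, smul_eq_mul]
      ring
    rw [hc]
    conv_lhs => rw [hM]
    simp only [mul_add, add_mul, smul_mul_assoc, mul_smul_comm, Matrix.sub_apply,
      Matrix.add_apply, Matrix.smul_apply, smul_eq_mul]
    ring
  have hint := fun M => (hcont M).integrable_of_hasCompactSupport (μ := haarU N)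
    (HasCompactSupport.of_compactSpace _)
  rw [integral_congr_ae (Filter.Eventually.of_forall hlin),
    integral_add (hint P) ((hint Q).const_mul _), integral_const_mul, hskew, hskew]
  simp

end TestFunctions

/-! ### The torus of eigenangles -/

instance instFactTwoPiPos : Fact (0 < 2 * π) := ⟨Real.two_pi_pos⟩

/-- The torus of `N`-tuples of eigenangles. -/
abbrev Torus (N : ℕ) : Type := Fin N → AddCircle (2 * π)

section Torus

variable {N : ℕ}

/-- The eigenvalue `exp (i θ_j)`. -/
def phase (θ : Torus N) (j : Fin N) : ℂ := (AddCircle.toCircle (θ j) : ℂ)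

theorem phase_ne_zero (θ : Torus N) (j : Fin N) : phase θ j ≠ 0 := Circle.coe_ne_zero _

theorem norm_phase (θ : Torus N) (j : Fin N) : ‖phase θ j‖ = 1 := Circle.norm_coe _

theorem star_phase (θ : Torus N) (j : Fin N) : star (phase θ j) = (phase θ j)⁻¹ := by
  rw [Complex.inv_eq_conj (norm_phase θ j)]; rfl

theorem continuous_phase (j : Fin N) : Continuous fun θ : Torus N => phase θ j := by
  unfold phase
  exact continuous_subtype_val.comp (AddCircle.continuous_toCircle.comp (continuous_apply j))

theorem continuous_phase_inv (j : Fin N) : Continuous fun θ : Torus N => (phase θ j)⁻¹ := by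
  simp only [← star_phase]
  exact (continuous_phase j).star

/-- Rotation of the `k`-th eigenangle. -/
def torusFlow (k : Fin N) (t : ℝ) (θ : Torus N) : Torus N :=
  θ + Pi.single k (t : AddCircle (2 * π))

theorem torusFlow_zero (k : Fin N) (θ : Torus N) : torusFlow k 0 θ = θ := by
  simp [torusFlow]

theorem measurePreserving_torusFlow (k : Fin N) (t : ℝ) :
    MeasurePreserving (torusFlow k t) (volume : Measure (Torus N)) volume :=
  measurePreserving_add_right _ _

theorem phase_torusFlow (k : Fin N) (t : ℝ) (θ : Torus N) (j : Fin N) :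
    phase (torusFlow k t θ) j =
      phase θ j * Complex.exp ((Pi.single k Complex.I : Fin N → ℂ) j * t) := by
  rcases eq_or_ne j k with rfl | h
  · simp [phase, torusFlow, AddCircle.toCircle_add, AddCircle.toCircle_apply_mk, Circle.coe_exp,
      mul_comm]
  · simp [phase, torusFlow, Pi.single_eq_of_ne h]

theorem hasDerivAt_phase_torusFlow (k : Fin N) (θ : Torus N) (j : Fin N) (t : ℝ) :
    HasDerivAt (fun t => phase (torusFlow k t θ) j)
      ((Pi.single k Complex.I : Fin N → ℂ) j * phase (torusFlow k t θ) j) t := by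
  simp only [phase_torusFlow]
  have h1 : HasDerivAt (fun t : ℝ => (Pi.single k Complex.I : Fin N → ℂ) j * (t : ℂ))
      ((Pi.single k Complex.I : Fin N → ℂ) j) t := by
    simpa using (Complex.ofRealCLM.hasDerivAt (x := t)).const_mul
      ((Pi.single k Complex.I : Fin N → ℂ) j)
  refine (h1.cexp.const_mul (phase θ j)).congr_deriv ?_
  ring

theorem hasDerivAt_phase_inv_torusFlow (k : Fin N) (θ : Torus N) (j : Fin N) (t : ℝ) :
    HasDerivAt (fun t => (phase (torusFlow k t θ) j)⁻¹)
      (-(Pi.single k Complex.I : Fin N → ℂ) j * (phase (torusFlow k t θ) j)⁻¹) t := by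
  refine ((hasDerivAt_phase_torusFlow k θ j t).inv (phase_ne_zero _ _)).congr_deriv ?_
  have := phase_ne_zero (torusFlow k t θ) j
  field_simp

/-- The diagonal unitary matrix with the given eigenangles. -/
def diagU (θ : Torus N) : U N :=
  ⟨diagonal (phase θ), by
    rw [mem_unitaryGroup_iff, star_eq_conjTranspose, diagonal_conjTranspose, diagonal_mul_diagonal,
      ← diagonal_one]
    congr 1
    funext j
    rw [Pi.star_apply, star_phase, mul_inv_cancel₀ (phase_ne_zero θ j)]⟩

theorem coe_diagU (θ : Torus N) : (diagU θ : Matrix (Fin N) (Fin N) ℂ) = diagonal (phase θ) := rfl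

theorem star_coe_diagU (θ : Torus N) :
    star (diagU θ : Matrix (Fin N) (Fin N) ℂ) = diagonal (fun j => (phase θ j)⁻¹) := by
  rw [coe_diagU, star_eq_conjTranspose, diagonal_conjTranspose]
  congr 1
  funext j
  rw [Pi.star_apply, star_phase]

theorem continuous_diagU : Continuous (diagU : Torus N → U N) := by
  refine Continuous.subtype_mk (Continuous.matrix_diagonal ?_) _
  exact continuous_pi continuous_phase

/-- The pairs `a < b` of indices. -/
def pairs (N : ℕ) : Finset (Fin N × Fin N) := Finset.univ.filter fun p => p.1 < p.2

/-- The factor `|z_a - z_b|² = (z_a - z_b)(z_a⁻¹ - z_b⁻¹)` of the Weyl density. -/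
def weylFactor (p : Fin N × Fin N) (θ : Torus N) : ℂ :=
  (phase θ p.1 - phase θ p.2) * ((phase θ p.1)⁻¹ - (phase θ p.2)⁻¹)

/-- The density `∏_{a < b} |z_a - z_b|²` of Weyl's integration formula, as a complex number. -/
def weylDensity (θ : Torus N) : ℂ := ∏ p ∈ pairs N, weylFactor p θ

/-- The partial derivative of `weylDensity` in the `k`-th eigenangle. -/
def weylDensityDeriv (k : Fin N) (θ : Torus N) : ℂ :=
  ∑ p ∈ pairs N, (∏ q ∈ (pairs N).erase p, weylFactor q θ) *
    (((Pi.single k Complex.I : Fin N → ℂ) p.1 - (Pi.single k Complex.I : Fin N → ℂ) p.2) *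
      (phase θ p.2 * (phase θ p.1)⁻¹ - phase θ p.1 * (phase θ p.2)⁻¹))

theorem continuous_weylFactor (p : Fin N × Fin N) : Continuous (weylFactor p) :=
  ((continuous_phase _).sub (continuous_phase _)).mul
    ((continuous_phase_inv _).sub (continuous_phase_inv _))

theorem continuous_weylDensity : Continuous (weylDensity : Torus N → ℂ) :=
  continuous_finsetProd _ fun p _ => continuous_weylFactor p

theorem continuous_weylDensityDeriv (k : Fin N) :
    Continuous (weylDensityDeriv k : Torus N → ℂ) :=
  continuous_finsetSum _ fun _ _ => (continuous_finsetProd _ fun q _ => continuous_weylFactor q).mul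
    (continuous_const.mul (((continuous_phase _).mul (continuous_phase_inv _)).sub
      ((continuous_phase _).mul (continuous_phase_inv _))))

theorem hasDerivAt_weylDensity (k : Fin N) (θ : Torus N) (t : ℝ) :
    HasDerivAt (fun t => weylDensity (torusFlow k t θ))
      (weylDensityDeriv k (torusFlow k t θ)) t := by
  unfold weylDensity weylDensityDeriv
  refine (HasDerivAt.fun_finsetProd (u := pairs N) (f := fun p t => weylFactor p (torusFlow k t θ))
    fun p _ => (((hasDerivAt_phase_torusFlow k θ p.1 t).sub
      (hasDerivAt_phase_torusFlow k θ p.2 t)).mul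
    ((hasDerivAt_phase_inv_torusFlow k θ p.1 t).sub
      (hasDerivAt_phase_inv_torusFlow k θ p.2 t)))).congr_deriv ?_
  refine Finset.sum_congr rfl fun p _ => ?_
  rw [smul_eq_mul]
  congr 1
  have h1 := phase_ne_zero (torusFlow k t θ) p.1
  have h2 := phase_ne_zero (torusFlow k t θ) p.2
  simp only [Pi.sub_apply]
  field_simp
  ring

/-- The logarithmic derivative of the Weyl density. At coinciding eigenvalues the quotient is `0`
by convention, and so are the density and its derivative. -/
theorem weylDensityDeriv_eq (k : Fin N) (θ : Torus N) :
    weylDensityDeriv k θ = weylDensity θ * ∑ p ∈ pairs N,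
      ((Pi.single k Complex.I : Fin N → ℂ) p.1 - (Pi.single k Complex.I : Fin N → ℂ) p.2) *
        ((phase θ p.1 + phase θ p.2) / (phase θ p.1 - phase θ p.2)) := by
  unfold weylDensityDeriv weylDensity
  rw [Finset.mul_sum]
  refine Finset.sum_congr rfl fun p hp => ?_
  rw [← Finset.prod_erase_mul _ _ hp, mul_assoc]
  congr 1
  have h1 := phase_ne_zero θ p.1
  have h2 := phase_ne_zero θ p.2
  unfold weylFactor
  by_cases h : phase θ p.1 = phase θ p.2
  · simp [h]
  · have h3 := sub_ne_zero.2 h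
    field_simp
    ring

theorem weylDensity_eq_zero {θ : Torus N} (h : ¬ Function.Injective (phase θ)) :
    weylDensity θ = 0 := by
  simp only [Function.Injective, not_forall] at h
  obtain ⟨a, b, hab, hne⟩ := h
  rcases lt_or_gt_of_ne hne with h | h
  · exact Finset.prod_eq_zero (i := (a, b)) (by simp [pairs, h]) (by simp [weylFactor, hab])
  · exact Finset.prod_eq_zero (i := (b, a)) (by simp [pairs, h]) (by simp [weylFactor, hab])

end Torus

/-! ### The divergence identity behind Weyl's formula -/

theorem sum_sum_eq_sum_pairs {N : ℕ} {M : Type*} [AddCommMonoid M] (g : Fin N → Fin N → M)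
    (hg : ∀ j, g j j = 0) :
    ∑ j, ∑ k, g j k = ∑ p ∈ pairs N, (g p.1 p.2 + g p.2 p.1) := by
  have h1 : ∀ p : Fin N × Fin N, g p.1 p.2 =
      (if p.1 < p.2 then g p.1 p.2 else 0) + (if p.2 < p.1 then g p.1 p.2 else 0) := by
    intro p
    rcases lt_trichotomy p.1 p.2 with h | h | h
    · simp [h, h.not_gt]
    · simp [h, hg]
    · simp [h, h.not_gt]
  rw [← Finset.sum_product', Finset.univ_product_univ, Finset.sum_congr rfl fun p _ => h1 p,
    Finset.sum_add_distrib, pairs, Finset.sum_add_distrib, Finset.sum_filter, Finset.sum_filter]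
  congr 1
  exact Fintype.sum_equiv (Equiv.prodComm _ _) _ _ fun p => rfl

section Divergence

variable {N : ℕ}

/-- The derivative of `diagonal (phase θ)` in the `k`-th eigenangle. -/
def diagDeriv (k : Fin N) (θ : Torus N) : Matrix (Fin N) (Fin N) ℂ :=
  diagonal fun j => (Pi.single k Complex.I : Fin N → ℂ) j * phase θ j

/-- The derivative of `diagonal (phase θ)⁻¹` in the `k`-th eigenangle. -/
def diagInvDeriv (k : Fin N) (θ : Torus N) : Matrix (Fin N) (Fin N) ℂ :=
  diagonal fun j => -(Pi.single k Complex.I : Fin N → ℂ) j * (phase θ j)⁻¹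

/-- The coefficient `z_k / (z_k - z_j)`, with the value `0` when `z_j = z_k`. -/
def weylCoeff (θ : Torus N) (j k : Fin N) : ℂ := phase θ k / (phase θ k - phase θ j)

theorem weylCoeff_self (θ : Torus N) (j : Fin N) : weylCoeff θ j j = 0 := by simp [weylCoeff]

variable (ℓ₁ ℓ₂ : Matrix (Fin N) (Fin N) ℂ →L[ℂ] ℂ)

/-- The test function `exp (ℓ₁ A + ℓ₂ A*)` at `A = V diag(e^{iθ}) V*`. -/
def testFn (V : U N) (θ : Torus N) : ℂ :=
  expConj ℓ₁ ℓ₂ (diagonal (phase θ)) (diagonal fun j => (phase θ j)⁻¹) V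

/-- The logarithmic derivative of `testFn` in the `k`-th eigenangle. -/
def angleDeriv (k : Fin N) (V : U N) (θ : Torus N) : ℂ :=
  ℓ₁ ((V : Matrix (Fin N) (Fin N) ℂ) * diagDeriv k θ * star (V : Matrix (Fin N) (Fin N) ℂ)) +
    ℓ₂ ((V : Matrix (Fin N) (Fin N) ℂ) * diagInvDeriv k θ * star (V : Matrix (Fin N) (Fin N) ℂ))

/-- The logarithmic derivative of `testFn` in the (complexified) right direction `M`. -/
def rightDeriv (V : U N) (θ : Torus N) (M : Matrix (Fin N) (Fin N) ℂ) : ℂ :=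
  commDeriv ℓ₁ ℓ₂ (diagonal (phase θ)) (diagonal fun j => (phase θ j)⁻¹) V M

/-- The logarithmic derivative of `testFn` under left translation `A ↦ exp (t X) A`. -/
def leftDeriv (X : Matrix (Fin N) (Fin N) ℂ) (V : U N) (θ : Torus N) : ℂ :=
  ℓ₁ (X * ((V : Matrix (Fin N) (Fin N) ℂ) * diagonal (phase θ) *
      star (V : Matrix (Fin N) (Fin N) ℂ))) -
    ℓ₂ ((V : Matrix (Fin N) (Fin N) ℂ) * (diagonal fun j => (phase θ j)⁻¹) *
      star (V : Matrix (Fin N) (Fin N) ℂ) * X)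

theorem rightDeriv_eq_sum (V : U N) (θ : Torus N) (W : Matrix (Fin N) (Fin N) ℂ) :
    rightDeriv ℓ₁ ℓ₂ V θ W = ∑ j, ∑ k, W j k * rightDeriv ℓ₁ ℓ₂ V θ (single j k (1 : ℂ)) := by
  have hW : W = ∑ j, ∑ k, W j k • single j k (1 : ℂ) := by
    conv_lhs => rw [matrix_eq_sum_single W]
    simp [smul_single]
  conv_lhs => rw [hW]
  simp only [rightDeriv, commDeriv, Finset.sum_mul, Finset.mul_sum, map_sum, smul_mul_assoc,
    mul_smul_comm, map_smul, smul_eq_mul, mul_sub, sub_mul, map_sub, mul_add,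
    Finset.sum_add_distrib, Finset.sum_sub_distrib]

/-- For distinct eigenvalues, an infinitesimal left translation of `A = V diag(z) V*` is a
combination of a motion of the eigenangles and a motion of `V` by the off-diagonal matrix
`W_{jk} = Y_{jk} z_k / (z_k - z_j)`, where `Y = V* X V`. -/
theorem leftDeriv_eq (X : Matrix (Fin N) (Fin N) ℂ) (V : U N) (θ : Torus N)
    (hθ : Function.Injective (phase θ)) :
    leftDeriv ℓ₁ ℓ₂ X V θ =
      ∑ k, (-Complex.I * (star (V : Matrix (Fin N) (Fin N) ℂ) * X * V) k k) *
        angleDeriv ℓ₁ ℓ₂ k V θ +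
      ∑ j, ∑ k, weylCoeff θ j k * ((star (V : Matrix (Fin N) (Fin N) ℂ) * X * V) j k *
        rightDeriv ℓ₁ ℓ₂ V θ (single j k (1 : ℂ))) := by
  set v : Matrix (Fin N) (Fin N) ℂ := (V : Matrix (Fin N) (Fin N) ℂ) with hv
  have hv1 : v * star v = 1 := mem_unitaryGroup_iff.1 V.2
  set Y := star v * X * v with hY
  set W : Matrix (Fin N) (Fin N) ℂ := Matrix.of fun j k => weylCoeff θ j k * Y j k with hW
  have hXv : X * v = v * Y := by
    rw [hY, ← mul_assoc, ← mul_assoc, hv1, one_mul]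
  have hvX : star v * X = Y * star v := by
    rw [hY, mul_assoc, mul_assoc, hv1, mul_one]
  have hoff : ∀ j k, j ≠ k → phase θ k - phase θ j ≠ 0 := fun j k hjk =>
    sub_ne_zero.2 fun h => hjk (hθ h).symm
  have h1 : Y * diagonal (phase θ) = ∑ k, (-Complex.I * Y k k) • diagDeriv k θ +
      (W * diagonal (phase θ) - diagonal (phase θ) * W) := by
    ext a b
    simp only [diagDeriv, Matrix.add_apply, Matrix.sub_apply, Matrix.sum_apply, Matrix.smul_apply,
      mul_diagonal, diagonal_mul, hW, Matrix.of_apply, smul_eq_mul]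
    rcases eq_or_ne a b with rfl | hab
    · simp only [diagonal_apply_eq, Pi.single_apply, weylCoeff_self]
      simp [ite_mul, mul_ite, Finset.sum_ite_eq]
      linear_combination (Y a a * phase θ a) * Complex.I_mul_I
    · simp only [diagonal_apply_ne _ hab, mul_zero, Finset.sum_const_zero, weylCoeff]
      have := hoff a b hab
      field_simp
      ring
  have h2 : -((diagonal fun j => (phase θ j)⁻¹) * Y) =
      ∑ k, (-Complex.I * Y k k) • diagInvDeriv k θ +
      (W * (diagonal fun j => (phase θ j)⁻¹) - (diagonal fun j => (phase θ j)⁻¹) * W) := by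
    ext a b
    simp only [diagInvDeriv, Matrix.add_apply, Matrix.sub_apply, Matrix.sum_apply,
      Matrix.smul_apply, mul_diagonal, diagonal_mul, hW, Matrix.of_apply, smul_eq_mul,
      Matrix.neg_apply]
    rcases eq_or_ne a b with rfl | hab
    · simp only [diagonal_apply_eq, Pi.single_apply, weylCoeff_self]
      simp [ite_mul, mul_ite, Finset.sum_ite_eq]
      linear_combination (-(Y a a * (phase θ a)⁻¹)) * Complex.I_mul_I
    · simp only [diagonal_apply_ne _ hab, mul_zero, Finset.sum_const_zero, weylCoeff]
      have := hoff a b hab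
      have ha := phase_ne_zero θ a
      have hb := phase_ne_zero θ b
      field_simp
      ring
  have h3 : leftDeriv ℓ₁ ℓ₂ X V θ = ℓ₁ (v * (Y * diagonal (phase θ)) * star v) +
      ℓ₂ (v * (-((diagonal fun j => (phase θ j)⁻¹) * Y)) * star v) := by
    rw [leftDeriv, sub_eq_add_neg, ← map_neg]
    congr 2
    · rw [← mul_assoc, ← mul_assoc, hXv, mul_assoc v]
    · rw [mul_assoc _ _ X, hvX]; noncomm_ring
  have h4 : ∑ j, ∑ k, weylCoeff θ j k * (Y j k * rightDeriv ℓ₁ ℓ₂ V θ (single j k (1 : ℂ))) =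
      rightDeriv ℓ₁ ℓ₂ V θ W := by
    rw [rightDeriv_eq_sum ℓ₁ ℓ₂ V θ W]
    simp only [hW, Matrix.of_apply, mul_assoc]
  rw [h3, h4, h1, h2]
  simp only [angleDeriv, rightDeriv, commDeriv, ← hv, mul_add, add_mul, map_add, Finset.mul_sum,
    Finset.sum_mul, map_sum, mul_smul_comm, smul_mul_assoc, map_smul, smul_eq_mul,
    Finset.sum_add_distrib]
  ring

/-- The logarithmic derivative of the Weyl density compensates the divergence of the
off-diagonal motion. -/
theorem sum_weylDensityDeriv_add (y : Fin N → ℂ) (θ : Torus N) :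
    ∑ k, (-Complex.I * y k) * weylDensityDeriv k θ +
      weylDensity θ * ∑ j, ∑ k, weylCoeff θ j k * (y j - y k) = 0 := by
  have h1 : ∑ k, (-Complex.I * y k) * weylDensityDeriv k θ = weylDensity θ *
      ∑ p ∈ pairs N, (y p.1 - y p.2) *
        ((phase θ p.1 + phase θ p.2) / (phase θ p.1 - phase θ p.2)) := by
    simp only [weylDensityDeriv_eq, Finset.mul_sum]
    rw [Finset.sum_comm]
    refine Finset.sum_congr rfl fun p _ => ?_
    have h : ∀ a : Fin N, ∑ k, y k * (Pi.single k Complex.I : Fin N → ℂ) a = y a * Complex.I := by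
      intro a
      simp [Pi.single_apply]
    calc _ = (-Complex.I) * (∑ k, y k * (Pi.single k Complex.I : Fin N → ℂ) p.1 -
          ∑ k, y k * (Pi.single k Complex.I : Fin N → ℂ) p.2) * (weylDensity θ *
            ((phase θ p.1 + phase θ p.2) / (phase θ p.1 - phase θ p.2))) := by
          rw [← Finset.sum_sub_distrib, Finset.mul_sum, Finset.sum_mul]
          refine Finset.sum_congr rfl fun k _ => ?_
          ring
      _ = _ := by
          rw [h, h]
          linear_combination (-(y p.1 - y p.2) * (weylDensity θ *
            ((phase θ p.1 + phase θ p.2) / (phase θ p.1 - phase θ p.2)))) * Complex.I_mul_I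
  by_cases hθ : Function.Injective (phase θ)
  · rw [h1, ← mul_add, sum_sum_eq_sum_pairs _ fun j => by simp, ← Finset.sum_add_distrib]
    rw [Finset.sum_eq_zero, mul_zero]
    intro p hp
    have hne : p.1 ≠ p.2 := (by simpa [pairs] using hp : p.1 < p.2).ne
    have h2 : phase θ p.1 - phase θ p.2 ≠ 0 := sub_ne_zero.2 fun h => hne (hθ h)
    have h3 : phase θ p.2 - phase θ p.1 ≠ 0 := sub_ne_zero.2 fun h => hne (hθ h).symm
    simp only [weylCoeff]
    have h4 : phase θ p.2 - phase θ p.1 = -(phase θ p.1 - phase θ p.2) := by ring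
    rw [h4]
    field_simp
    ring
  · rw [h1, weylDensity_eq_zero hθ]; simp

/-- The divergence identity: the derivative under left translation, weighted by the Weyl density,
is a sum of total derivatives. -/
theorem weylDensity_mul_leftDeriv (X : Matrix (Fin N) (Fin N) ℂ) (V : U N) (θ : Torus N) :
    weylDensity θ * leftDeriv ℓ₁ ℓ₂ X V θ =
      ∑ k, (-Complex.I * (star (V : Matrix (Fin N) (Fin N) ℂ) * X * V) k k) *
        (weylDensityDeriv k θ + weylDensity θ * angleDeriv ℓ₁ ℓ₂ k V θ) +
      weylDensity θ * ∑ j, ∑ k, weylCoeff θ j k *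
        ((star (V : Matrix (Fin N) (Fin N) ℂ) * X * V) j k *
          rightDeriv ℓ₁ ℓ₂ V θ (single j k (1 : ℂ)) +
        ((star (V : Matrix (Fin N) (Fin N) ℂ) * X * (V : Matrix (Fin N) (Fin N) ℂ)) *
          single j k (1 : ℂ) -
          single j k (1 : ℂ) *
            (star (V : Matrix (Fin N) (Fin N) ℂ) * X * (V : Matrix (Fin N) (Fin N) ℂ))) j k) := by
  set Y : Matrix (Fin N) (Fin N) ℂ :=
    star (V : Matrix (Fin N) (Fin N) ℂ) * X * (V : Matrix (Fin N) (Fin N) ℂ) with hY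
  have h1 : ∀ j k : Fin N, (Y * single j k (1 : ℂ) - single j k (1 : ℂ) * Y) j k =
    Y j j - Y k k := by
    intro j k
    simp
  have h2 := sum_weylDensityDeriv_add (fun k => Y k k) θ
  simp only [h1, mul_add, Finset.sum_add_distrib]
  by_cases hθ : Function.Injective (phase θ)
  · rw [leftDeriv_eq ℓ₁ ℓ₂ X V θ hθ, ← hY]
    have h3 : ∑ k, -Complex.I * Y k k * (weylDensity θ * angleDeriv ℓ₁ ℓ₂ k V θ) =
        weylDensity θ * ∑ k, -Complex.I * Y k k * angleDeriv ℓ₁ ℓ₂ k V θ := by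
      rw [Finset.mul_sum]
      exact Finset.sum_congr rfl fun k _ => by ring
    rw [h3]
    linear_combination -h2
  · simp [weylDensityDeriv_eq, weylDensity_eq_zero hθ]

/-! ### Invariance of the law of `V diag(e^{iθ}) V*` -/

theorem continuous_diagonal_phase :
    Continuous fun θ : Torus N => (diagonal (phase θ) : Matrix (Fin N) (Fin N) ℂ) :=
  Continuous.matrix_diagonal (continuous_pi continuous_phase)

theorem continuous_diagonal_phase_inv :
    Continuous fun θ : Torus N =>
      (diagonal fun j => (phase θ j)⁻¹ : Matrix (Fin N) (Fin N) ℂ) :=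
  Continuous.matrix_diagonal (continuous_pi continuous_phase_inv)

theorem continuous_testFn :
    Continuous fun q : U N × Torus N => testFn ℓ₁ ℓ₂ q.1 q.2 := by
  unfold testFn expConj
  have := (continuous_diagonal_phase (N := N)).comp (continuous_snd (X := U N))
  have := (continuous_diagonal_phase_inv (N := N)).comp (continuous_snd (X := U N))
  simp only [Function.comp_def] at *
  fun_prop

theorem continuous_leftDeriv (X : Matrix (Fin N) (Fin N) ℂ) :
    Continuous fun q : U N × Torus N => leftDeriv ℓ₁ ℓ₂ X q.1 q.2 := by
  unfold leftDeriv
  have := (continuous_diagonal_phase (N := N)).comp (continuous_snd (X := U N))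
  have := (continuous_diagonal_phase_inv (N := N)).comp (continuous_snd (X := U N))
  simp only [Function.comp_def] at *
  fun_prop

theorem continuous_angleDeriv (k : Fin N) :
    Continuous fun q : U N × Torus N => angleDeriv ℓ₁ ℓ₂ k q.1 q.2 := by
  unfold angleDeriv
  have h1 : Continuous fun q : U N × Torus N => diagDeriv k q.2 :=
    Continuous.matrix_diagonal (continuous_pi fun j =>
      continuous_const.mul ((continuous_phase j).comp continuous_snd))
  have h2 : Continuous fun q : U N × Torus N => diagInvDeriv k q.2 :=
    Continuous.matrix_diagonal (continuous_pi fun j =>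
      continuous_const.mul ((continuous_phase_inv j).comp continuous_snd))
  fun_prop

theorem hasDerivAt_testFn (k : Fin N) (V : U N) (θ : Torus N) (t : ℝ) :
    HasDerivAt (fun t => testFn ℓ₁ ℓ₂ V (torusFlow k t θ))
      (angleDeriv ℓ₁ ℓ₂ k V (torusFlow k t θ) * testFn ℓ₁ ℓ₂ V (torusFlow k t θ)) t := by
  have hd : HasDerivAt (fun t => (diagonal (phase (torusFlow k t θ)) : Matrix (Fin N) (Fin N) ℂ))
      (diagDeriv k (torusFlow k t θ)) t := by
    refine hasDerivAt_pi.2 fun i => hasDerivAt_pi.2 fun j => ?_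
    rcases eq_or_ne i j with rfl | h
    · simpa [diagDeriv] using hasDerivAt_phase_torusFlow k θ i t
    · simpa [diagDeriv, diagonal_apply_ne _ h] using hasDerivAt_const t (0 : ℂ)
  have hd' : HasDerivAt (fun t => (diagonal (fun j => (phase (torusFlow k t θ) j)⁻¹) :
      Matrix (Fin N) (Fin N) ℂ)) (diagInvDeriv k (torusFlow k t θ)) t := by
    refine hasDerivAt_pi.2 fun i => hasDerivAt_pi.2 fun j => ?_
    rcases eq_or_ne i j with rfl | h
    · simpa [diagInvDeriv] using hasDerivAt_phase_inv_torusFlow k θ i t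
    · simpa [diagInvDeriv, diagonal_apply_ne _ h] using hasDerivAt_const t (0 : ℂ)
  have h1 := (ℓ₁.restrictScalars ℝ).hasFDerivAt.comp_hasDerivAt t
    ((hd.const_mul (V : Matrix (Fin N) (Fin N) ℂ)).mul_const
      (star (V : Matrix (Fin N) (Fin N) ℂ)))
  have h2 := (ℓ₂.restrictScalars ℝ).hasFDerivAt.comp_hasDerivAt t
    ((hd'.const_mul (V : Matrix (Fin N) (Fin N) ℂ)).mul_const
      (star (V : Matrix (Fin N) (Fin N) ℂ)))
  refine (h1.add h2).cexp.congr_deriv ?_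
  simp only [testFn, angleDeriv, expConj]
  rw [mul_comm]
  rfl

/-- Integration by parts on the torus. -/
theorem integral_angle_by_parts (X : Matrix (Fin N) (Fin N) ℂ) (k : Fin N) :
    ∫ q : U N × Torus N, (-Complex.I * (star (q.1 : Matrix (Fin N) (Fin N) ℂ) * X * q.1) k k) *
      (weylDensityDeriv k q.2 + weylDensity q.2 * angleDeriv ℓ₁ ℓ₂ k q.1 q.2) *
        testFn ℓ₁ ℓ₂ q.1 q.2 ∂((haarU N).prod volume) = 0 := by
  have c1 := (continuous_weylDensityDeriv k).comp (continuous_snd (X := U N))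
  have c2 := (continuous_weylDensity (N := N)).comp (continuous_snd (X := U N))
  have c3 := continuous_angleDeriv ℓ₁ ℓ₂ k
  have c4 := continuous_testFn ℓ₁ ℓ₂
  simp only [Function.comp_def] at c1 c2
  refine integral_deriv_flow_eq_zero_of_continuous
    (fun t (q : U N × Torus N) => (q.1, torusFlow k t q.2))
    (fun t => (MeasurePreserving.id (haarU N)).prod (measurePreserving_torusFlow k t))
    (fun q => by simp [torusFlow_zero])
    (Φ := fun q => (-Complex.I * (star (q.1 : Matrix (Fin N) (Fin N) ℂ) * X * q.1) k k) *
      (weylDensity q.2 * testFn ℓ₁ ℓ₂ q.1 q.2)) (by fun_prop) (by fun_prop) ?_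
  intro q t
  dsimp only
  refine (((hasDerivAt_weylDensity k q.2 t).fun_mul
    (hasDerivAt_testFn ℓ₁ ℓ₂ k q.1 q.2 t)).const_mul _).congr_deriv ?_
  ring

theorem integral_weylDensity_mul_leftDeriv (X : Matrix (Fin N) (Fin N) ℂ) :
    ∫ q : U N × Torus N, weylDensity q.2 * leftDeriv ℓ₁ ℓ₂ X q.1 q.2 * testFn ℓ₁ ℓ₂ q.1 q.2
      ∂((haarU N).prod volume) = 0 := by
  have c1 := fun k : Fin N => (continuous_weylDensityDeriv k).comp (continuous_snd (X := U N))
  have c2 := (continuous_weylDensity (N := N)).comp (continuous_snd (X := U N))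
  have c3 := continuous_angleDeriv ℓ₁ ℓ₂
  have c4 := continuous_testFn ℓ₁ ℓ₂
  have c5 := continuous_leftDeriv ℓ₁ ℓ₂ X
  simp only [Function.comp_def] at c1 c2
  set A : U N × Torus N → ℂ := fun q => ∑ k,
    (-Complex.I * (star (q.1 : Matrix (Fin N) (Fin N) ℂ) * X * q.1) k k) *
      (weylDensityDeriv k q.2 + weylDensity q.2 * angleDeriv ℓ₁ ℓ₂ k q.1 q.2) *
        testFn ℓ₁ ℓ₂ q.1 q.2 with hA
  set G : U N × Torus N → ℂ := fun q =>
    weylDensity q.2 * leftDeriv ℓ₁ ℓ₂ X q.1 q.2 * testFn ℓ₁ ℓ₂ q.1 q.2 with hG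
  have hAk : ∀ k : Fin N, Continuous fun q : U N × Torus N =>
      (-Complex.I * (star (q.1 : Matrix (Fin N) (Fin N) ℂ) * X * q.1) k k) *
      (weylDensityDeriv k q.2 + weylDensity q.2 * angleDeriv ℓ₁ ℓ₂ k q.1 q.2) *
        testFn ℓ₁ ℓ₂ q.1 q.2 := by
    intro k
    have := c1 k
    have := c3 k
    fun_prop
  have hAc : Continuous A := continuous_finsetSum _ fun k _ => hAk k
  have hGc : Continuous G := by fun_prop
  have hint : ∀ f : U N × Torus N → ℂ, Continuous f → Integrable f ((haarU N).prod volume) :=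
    fun f hf => hf.integrable_of_hasCompactSupport (HasCompactSupport.of_compactSpace _)
  have hAint : ∫ q, A q ∂((haarU N).prod volume) = 0 := by
    rw [hA, integral_finsetSum _ fun k _ => hint _ (hAk k)]
    exact Finset.sum_eq_zero fun k _ => integral_angle_by_parts ℓ₁ ℓ₂ X k
  -- For fixed angles the remainder is a sum of total derivatives in `V`.
  have hrem : ∫ q, (G q - A q) ∂((haarU N).prod volume) = 0 := by
    rw [integral_prod_symm (fun q => G q - A q) ((hint _ hGc).sub (hint _ hAc))]
    refine integral_eq_zero_of_ae (Filter.Eventually.of_forall fun θ => ?_)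
    have hpt : ∀ V : U N, G (V, θ) - A (V, θ) = ∑ j, ∑ k, weylDensity θ * weylCoeff θ j k *
        (((star (V : Matrix (Fin N) (Fin N) ℂ) * X * V) j k *
          rightDeriv ℓ₁ ℓ₂ V θ (single j k (1 : ℂ)) +
        ((star (V : Matrix (Fin N) (Fin N) ℂ) * X * (V : Matrix (Fin N) (Fin N) ℂ)) *
          single j k (1 : ℂ) -
          single j k (1 : ℂ) *
            (star (V : Matrix (Fin N) (Fin N) ℂ) * X * (V : Matrix (Fin N) (Fin N) ℂ))) j k) *
            testFn ℓ₁ ℓ₂ V θ) := by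
      intro V
      simp only [hG, hA]
      rw [weylDensity_mul_leftDeriv, add_mul, ← Finset.sum_mul, add_sub_cancel_left,
        Finset.mul_sum, Finset.sum_mul]
      refine Finset.sum_congr rfl fun j _ => ?_
      rw [Finset.mul_sum, Finset.sum_mul]
      refine Finset.sum_congr rfl fun k _ => ?_
      ring
    have hVc : ∀ j k : Fin N, Integrable (fun V : U N =>
        ((star (V : Matrix (Fin N) (Fin N) ℂ) * X * V) j k *
          rightDeriv ℓ₁ ℓ₂ V θ (single j k (1 : ℂ)) +
        ((star (V : Matrix (Fin N) (Fin N) ℂ) * X * (V : Matrix (Fin N) (Fin N) ℂ)) *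
          single j k (1 : ℂ) -
          single j k (1 : ℂ) *
            (star (V : Matrix (Fin N) (Fin N) ℂ) * X * (V : Matrix (Fin N) (Fin N) ℂ))) j k) *
            testFn ℓ₁ ℓ₂ V θ) (haarU N) := by
      intro j k
      have h1 : Continuous fun V : U N => rightDeriv ℓ₁ ℓ₂ V θ (single j k (1 : ℂ)) :=
        continuous_commDeriv _ _ _ _ _
      have h2 : Continuous fun V : U N => testFn ℓ₁ ℓ₂ V θ := continuous_expConj _ _ _ _
      refine Continuous.integrable_of_hasCompactSupport ?_ (HasCompactSupport.of_compactSpace _)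
      fun_prop
    simp only [hpt]
    rw [integral_finsetSum _ fun j _ => integrable_finsetSum _ fun k _ => (hVc j k).const_mul _]
    refine Finset.sum_eq_zero fun j _ => ?_
    rw [integral_finsetSum _ fun k _ => (hVc j k).const_mul _]
    refine Finset.sum_eq_zero fun k _ => ?_
    rw [integral_const_mul]
    have := integral_haarU_by_parts ℓ₁ ℓ₂ (diagonal (phase θ)) (diagonal fun j => (phase θ j)⁻¹)
      X (single j k (1 : ℂ)) j k
    simp only [rightDeriv, testFn]
    rw [this, mul_zero]
  rw [integral_sub (hint _ hGc) (hint _ hAc), hAint, sub_zero] at hrem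
  exact hrem

end Divergence

/-! ### Weyl's integration formula -/

section Weyl

variable {N : ℕ}

/-- The density `∏_{a < b} |e^{iθ_a} - e^{iθ_b}|²` on the torus. -/
def weylDensityReal (θ : Torus N) : ℝ := ∏ p ∈ pairs N, ‖phase θ p.1 - phase θ p.2‖ ^ 2

theorem weylDensityReal_nonneg (θ : Torus N) : 0 ≤ weylDensityReal θ :=
  Finset.prod_nonneg fun _ _ => by positivity

theorem ofReal_weylDensityReal (θ : Torus N) : (weylDensityReal θ : ℂ) = weylDensity θ := by
  unfold weylDensityReal weylDensity
  push_cast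
  refine Finset.prod_congr rfl fun p _ => ?_
  rw [weylFactor, ← star_phase, ← star_phase, ← star_sub, ← Complex.mul_conj']
  rfl

theorem continuous_weylDensityReal : Continuous (weylDensityReal : Torus N → ℝ) :=
  continuous_finsetProd _ fun _ _ => (((continuous_phase _).sub (continuous_phase _)).norm).pow 2

/-- The measure on the torus with the Weyl density. -/
def torusMeasure (N : ℕ) : Measure (Torus N) :=
  volume.withDensity fun θ => ENNReal.ofReal (weylDensityReal θ)

instance instIsFiniteMeasureTorusMeasure (N : ℕ) : IsFiniteMeasure (torusMeasure N) :=
  isFiniteMeasure_withDensity_ofReal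
    (continuous_weylDensityReal.integrable_of_hasCompactSupport
      (HasCompactSupport.of_compactSpace _)).2

/-- The unitary matrix `V diag(e^{iθ}) V*`. -/
def conjDiag (q : U N × Torus N) : U N := q.1 * diagU q.2 * q.1⁻¹

theorem continuous_conjDiag : Continuous (conjDiag : U N × Torus N → U N) := by
  unfold conjDiag
  have := (continuous_diagU (N := N)).comp (continuous_snd (X := U N))
  simp only [Function.comp_def] at this
  fun_prop

theorem coe_conjDiag (q : U N × Torus N) : (conjDiag q : Matrix (Fin N) (Fin N) ℂ) =
    (q.1 : Matrix (Fin N) (Fin N) ℂ) * diagonal (phase q.2) *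
      star (q.1 : Matrix (Fin N) (Fin N) ℂ) := rfl

theorem star_coe_conjDiag (q : U N × Torus N) : star (conjDiag q : Matrix (Fin N) (Fin N) ℂ) =
    (q.1 : Matrix (Fin N) (Fin N) ℂ) * (diagonal fun j => (phase q.2 j)⁻¹) *
      star (q.1 : Matrix (Fin N) (Fin N) ℂ) := by
  rw [coe_conjDiag, star_mul, star_mul, star_star, ← coe_diagU, star_coe_diagU, mul_assoc]

/-- The law of `V diag(e^{iθ}) V*` for `V` Haar distributed and `θ` with the Weyl density. -/
def weylMeasure (N : ℕ) : Measure (U N) := ((haarU N).prod (torusMeasure N)).map conjDiag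

instance instIsFiniteMeasureWeylMeasure (N : ℕ) : IsFiniteMeasure (weylMeasure N) := by
  unfold weylMeasure; infer_instance

theorem integral_weylMeasure {g : U N → ℂ} (hg : Continuous g) :
    ∫ A, g A ∂(weylMeasure N) =
      ∫ q, weylDensity q.2 * g (conjDiag q) ∂((haarU N).prod volume) := by
  have hm : Measurable fun q : U N × Torus N => ENNReal.ofReal (weylDensityReal q.2) :=
    (continuous_weylDensityReal.measurable.comp measurable_snd).ennreal_ofReal
  rw [weylMeasure, integral_map continuous_conjDiag.aemeasurable hg.aestronglyMeasurable,
    torusMeasure, prod_withDensity_right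
      continuous_weylDensityReal.measurable.ennreal_ofReal,
    integral_withDensity_eq_integral_toReal_smul hm
      (Filter.Eventually.of_forall fun _ => ENNReal.ofReal_lt_top)]
  refine integral_congr_ae (Filter.Eventually.of_forall fun q => ?_)
  dsimp only
  rw [ENNReal.toReal_ofReal (weylDensityReal_nonneg _), ← ofReal_weylDensityReal]
  rfl

variable (ℓ₁ ℓ₂ : Matrix (Fin N) (Fin N) ℂ →L[ℂ] ℂ)

/-- The functional `A ↦ ℓ (B A)`. -/
def compLeft (ℓ : Matrix (Fin N) (Fin N) ℂ →L[ℂ] ℂ) (B : Matrix (Fin N) (Fin N) ℂ) :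
    Matrix (Fin N) (Fin N) ℂ →L[ℂ] ℂ :=
  ℓ.comp (ContinuousLinearMap.mul ℂ (Matrix (Fin N) (Fin N) ℂ) B)

/-- The functional `A ↦ ℓ (A B)`. -/
def compRight (ℓ : Matrix (Fin N) (Fin N) ℂ →L[ℂ] ℂ) (B : Matrix (Fin N) (Fin N) ℂ) :
    Matrix (Fin N) (Fin N) ℂ →L[ℂ] ℂ :=
  ℓ.comp ((ContinuousLinearMap.mul ℂ (Matrix (Fin N) (Fin N) ℂ)).flip B)

theorem compLeft_apply (ℓ : Matrix (Fin N) (Fin N) ℂ →L[ℂ] ℂ) (B A : Matrix (Fin N) (Fin N) ℂ) :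
    compLeft ℓ B A = ℓ (B * A) := rfl

theorem compRight_apply (ℓ : Matrix (Fin N) (Fin N) ℂ →L[ℂ] ℂ) (B A : Matrix (Fin N) (Fin N) ℂ) :
    compRight ℓ B A = ℓ (A * B) := rfl

theorem continuous_expFlow (H : selfAdjoint (Matrix (Fin N) (Fin N) ℂ)) :
    Continuous (expFlow H) := by
  unfold expFlow
  fun_prop

theorem hasDerivAt_exp_left (H : selfAdjoint (Matrix (Fin N) (Fin N) ℂ)) (V : U N) (θ : Torus N)
    (t : ℝ) :
    HasDerivAt (fun t : ℝ => testFn (compLeft ℓ₁ (expFlow H t : Matrix (Fin N) (Fin N) ℂ))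
        (compRight ℓ₂ (star (expFlow H t : Matrix (Fin N) (Fin N) ℂ))) V θ)
      (leftDeriv (compLeft ℓ₁ (expFlow H t : Matrix (Fin N) (Fin N) ℂ))
        (compRight ℓ₂ (star (expFlow H t : Matrix (Fin N) (Fin N) ℂ)))
        (Complex.I • (H : Matrix (Fin N) (Fin N) ℂ)) V θ *
      testFn (compLeft ℓ₁ (expFlow H t : Matrix (Fin N) (Fin N) ℂ))
        (compRight ℓ₂ (star (expFlow H t : Matrix (Fin N) (Fin N) ℂ))) V θ) t := by
  set A := (V : Matrix (Fin N) (Fin N) ℂ) * diagonal (phase θ) *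
      star (V : Matrix (Fin N) (Fin N) ℂ) with hA
  set A' := (V : Matrix (Fin N) (Fin N) ℂ) * (diagonal fun j => (phase θ j)⁻¹) *
      star (V : Matrix (Fin N) (Fin N) ℂ) with hA'
  have h1 := (ℓ₁.restrictScalars ℝ).hasFDerivAt.comp_hasDerivAt t
    ((hasDerivAt_expFlow H t).mul_const A)
  have h2 := (ℓ₂.restrictScalars ℝ).hasFDerivAt.comp_hasDerivAt t
    ((hasDerivAt_star_expFlow H t).const_mul A')
  refine (h1.add h2).cexp.congr_deriv ?_
  simp only [testFn, expConj, leftDeriv, compLeft_apply, compRight_apply, ← hA, ← hA']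
  rw [mul_comm]
  congr 1
  simp only [ContinuousLinearMap.coe_restrictScalars', mul_neg, map_neg, mul_assoc]
  ring

/-- The left side is constant in `t`, its derivative being the integral of a divergence. -/
theorem integral_testFn_left_invariant (H : selfAdjoint (Matrix (Fin N) (Fin N) ℂ)) (t : ℝ) :
    ∫ q : U N × Torus N, weylDensity q.2 *
        testFn (compLeft ℓ₁ (expFlow H t : Matrix (Fin N) (Fin N) ℂ))
        (compRight ℓ₂ (star (expFlow H t : Matrix (Fin N) (Fin N) ℂ))) q.1 q.2
          ∂((haarU N).prod volume) =
      ∫ q : U N × Torus N, weylDensity q.2 * testFn ℓ₁ ℓ₂ q.1 q.2 ∂((haarU N).prod volume) := by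
  set L₁ : ℝ → Matrix (Fin N) (Fin N) ℂ →L[ℂ] ℂ := fun t =>
    compLeft ℓ₁ (expFlow H t : Matrix (Fin N) (Fin N) ℂ) with hL₁
  set L₂ : ℝ → Matrix (Fin N) (Fin N) ℂ →L[ℂ] ℂ := fun t =>
    compRight ℓ₂ (star (expFlow H t : Matrix (Fin N) (Fin N) ℂ)) with hL₂
  set X := Complex.I • (H : Matrix (Fin N) (Fin N) ℂ) with hX
  set F : ℝ → U N × Torus N → ℂ := fun t q => weylDensity q.2 * testFn (L₁ t) (L₂ t) q.1 q.2
    with hF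
  set F' : ℝ → U N × Torus N → ℂ := fun t q => weylDensity q.2 *
    leftDeriv (L₁ t) (L₂ t) X q.1 q.2 * testFn (L₁ t) (L₂ t) q.1 q.2 with hF'
  have hFc : ∀ t, Continuous (F t) := fun t =>
    (continuous_weylDensity.comp continuous_snd).mul (continuous_testFn _ _)
  have hF'c : Continuous fun r : ℝ × (U N × Torus N) => F' r.1 r.2 := by
    have c1 := (continuous_weylDensity (N := N)).comp
      ((continuous_snd (X := U N)).comp (continuous_snd (X := ℝ)))
    have c2 := (continuous_diagonal_phase (N := N)).comp
      ((continuous_snd (X := U N)).comp (continuous_snd (X := ℝ)))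
    have c3 := (continuous_diagonal_phase_inv (N := N)).comp
      ((continuous_snd (X := U N)).comp (continuous_snd (X := ℝ)))
    have c4 := continuous_subtype_val.comp
      ((continuous_expFlow H).comp (continuous_fst (Y := U N × Torus N)))
    simp only [Function.comp_def] at c1 c2 c3 c4
    simp only [hF', hL₁, hL₂, testFn, expConj, leftDeriv, compLeft_apply, compRight_apply]
    generalize expFlow H = g at c4 ⊢
    clear_value X
    fun_prop
  have hderiv : ∀ t₀ : ℝ, HasDerivAt (fun t => ∫ q, F t q ∂((haarU N).prod volume)) 0 t₀ := by
    intro t₀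
    obtain ⟨C, hC⟩ := ((isCompact_Icc (a := t₀ - 1) (b := t₀ + 1)).prod
      (isCompact_univ (X := U N × Torus N))).exists_bound_of_continuousOn hF'c.continuousOn
    have key := hasDerivAt_integral_of_dominated_loc_of_deriv_le
      (μ := (haarU N).prod (volume : Measure (Torus N))) (x₀ := t₀) (F := F) (F' := F')
      (bound := fun _ => C) (s := Set.Icc (t₀ - 1) (t₀ + 1))
      (Icc_mem_nhds (by linarith) (by linarith))
      (Filter.Eventually.of_forall fun t => (hFc t).aestronglyMeasurable)
      ((hFc t₀).integrable_of_hasCompactSupport (HasCompactSupport.of_compactSpace _))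
      (hF'c.comp (Continuous.prodMk_right t₀)).aestronglyMeasurable
      (Filter.Eventually.of_forall fun q t ht => hC (t, q) ⟨ht, trivial⟩)
      (integrable_const C)
      (Filter.Eventually.of_forall fun q t _ =>
        ((hasDerivAt_exp_left ℓ₁ ℓ₂ H q.1 q.2 t).const_mul (weylDensity q.2)).congr_deriv
          (mul_assoc _ _ _).symm)
    have h0 := integral_weylDensity_mul_leftDeriv (L₁ t₀) (L₂ t₀) X
    have h1 := key.2
    simp only [hF'] at h1
    rwa [h0] at h1
  have hconst := is_const_of_deriv_eq_zero
    (fun t => (hderiv t).differentiableAt) (fun t => (hderiv t).deriv) t 0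
  simp only [hF] at hconst
  rw [hconst]
  simp only [hL₁, hL₂, expFlow_zero]
  refine integral_congr_ae (Filter.Eventually.of_forall fun q => ?_)
  simp [testFn, expConj, compLeft_apply, compRight_apply]

/-- Every real linear functional is of the form `A ↦ ℓ₁ A + ℓ₂ A*` with complex linear
`ℓ₁` and `ℓ₂`. -/
theorem exists_complex_decomposition (L : StrongDual ℝ (Matrix (Fin N) (Fin N) ℂ)) :
    ∃ ℓ₁ ℓ₂ : Matrix (Fin N) (Fin N) ℂ →L[ℂ] ℂ, ∀ A,
      (L A : ℂ) * Complex.I = ℓ₁ A + ℓ₂ (star A) := by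
  let ℓ₁ : Matrix (Fin N) (Fin N) ℂ →ₗ[ℂ] ℂ :=
    { toFun := fun A => Complex.I / 2 * (L A - Complex.I * L (Complex.I • A))
      map_add' := fun A B => by simp only [smul_add, map_add, Complex.ofReal_add]; ring
      map_smul' := fun c A => by
        have h1 : c • A = c.re • A + c.im • (Complex.I • A) := by
          rw [← Complex.coe_smul c.re A, ← Complex.coe_smul c.im (Complex.I • A), smul_smul,
            ← add_smul, Complex.re_add_im]
        have h2 : Complex.I • c • A = c.re • (Complex.I • A) - c.im • A := by
          rw [← Complex.coe_smul c.im A, ← Complex.coe_smul c.re (Complex.I • A), smul_smul,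
            smul_smul, ← sub_smul]
          congr 1
          conv_lhs => rw [← Complex.re_add_im c]
          linear_combination (c.im : ℂ) * Complex.I_mul_I
        rw [h2, h1]
        simp only [map_add, map_sub, map_smul, smul_eq_mul, Complex.ofReal_add, Complex.ofReal_sub,
          Complex.ofReal_mul, RingHom.id_apply]
        conv_rhs => rw [← Complex.re_add_im c]
        linear_combination (Complex.I / 2 * c.im * L (Complex.I • A)) * Complex.I_mul_I }
  let ℓ₂ : Matrix (Fin N) (Fin N) ℂ →ₗ[ℂ] ℂ :=
    { toFun := fun A => Complex.I / 2 * (L (star A) + Complex.I * L (Complex.I • star A))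
      map_add' := fun A B => by simp only [star_add, smul_add, map_add, Complex.ofReal_add]; ring
      map_smul' := fun c A => by
        have h1 : star (c • A) = c.re • star A - c.im • (Complex.I • star A) := by
          rw [← Complex.coe_smul c.re (star A), ← Complex.coe_smul c.im (Complex.I • star A),
            smul_smul, ← sub_smul, star_smul]
          congr 1
          exact Complex.ext (by simp) (by simp)
        have h2 : Complex.I • star (c • A) = c.re • (Complex.I • star A) + c.im • star A := by
          rw [h1, smul_sub, smul_comm _ c.re, smul_comm _ c.im, smul_smul, Complex.I_mul_I]
          simp
        rw [h2, h1]
        simp only [map_add, map_sub, map_smul, smul_eq_mul, Complex.ofReal_add, Complex.ofReal_sub,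
          Complex.ofReal_mul, RingHom.id_apply]
        conv_rhs => rw [← Complex.re_add_im c]
        linear_combination (-(Complex.I / 2) * c.im * L (Complex.I • star A)) * Complex.I_mul_I }
  refine ⟨ℓ₁.toContinuousLinearMap, ℓ₂.toContinuousLinearMap, fun A => ?_⟩
  simp only [LinearMap.coe_toContinuousLinearMap', ℓ₁, ℓ₂, LinearMap.coe_mk, AddHom.coe_mk,
    star_star]
  ring

/-- Invariance under `exp (i t H)`: seen as measures on the space of all matrices, the two sides
have the same characteristic function. -/
theorem map_expFlow_mul_weylMeasure (H : selfAdjoint (Matrix (Fin N) (Fin N) ℂ)) (t : ℝ) :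
    (weylMeasure N).map (expFlow H t * ·) = weylMeasure N := by
  let : MeasurableSpace (Matrix (Fin N) (Fin N) ℂ) := borel _
  have : BorelSpace (Matrix (Fin N) (Fin N) ℂ) := ⟨rfl⟩
  have hemb : MeasurableEmbedding (Subtype.val : U N → Matrix (Fin N) (Fin N) ℂ) := by
    have hcl : Topology.IsClosedEmbedding (Subtype.val : U N → Matrix (Fin N) (Fin N) ℂ) :=
      continuous_subtype_val.isClosedEmbedding Subtype.val_injective
    exact hcl.measurableEmbedding
  have hmul : Continuous (expFlow H t * · : U N → U N) := continuous_const_mul _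
  have hfin : IsFiniteMeasure ((weylMeasure N).map (expFlow H t * ·)) := inferInstance
  have key : ((weylMeasure N).map (expFlow H t * ·)).map Subtype.val =
      (weylMeasure N).map Subtype.val := by
    refine Measure.ext_of_charFunDual (funext fun L => ?_)
    obtain ⟨ℓ₁, ℓ₂, hℓ⟩ := exists_complex_decomposition L
    have hcont : Continuous fun A : Matrix (Fin N) (Fin N) ℂ =>
        Complex.exp ((L A : ℂ) * Complex.I) := by
      have := L.continuous
      fun_prop
    have hcont' := hcont.comp (continuous_subtype_val (p := (· ∈ unitaryGroup (Fin N) ℂ)))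
    simp only [Function.comp_def] at hcont'
    have hcont'' := hcont'.comp hmul
    simp only [Function.comp_def] at hcont''
    rw [charFunDual_apply, charFunDual_apply,
      integral_map hemb.measurable.aemeasurable hcont.aestronglyMeasurable,
      integral_map hemb.measurable.aemeasurable hcont.aestronglyMeasurable,
      integral_map hmul.aemeasurable hcont'.aestronglyMeasurable,
      integral_weylMeasure hcont',
      integral_weylMeasure hcont'']
    have h := integral_testFn_left_invariant ℓ₁ ℓ₂ H t
    simp only [hℓ, Submonoid.coe_mul, star_mul, star_coe_conjDiag]
    simp only [coe_conjDiag]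
    exact h
  ext s hs
  have := congrArg (fun μ => μ (Subtype.val '' s)) key
  rwa [hemb.map_apply, hemb.map_apply, Set.preimage_image_eq _ Subtype.val_injective] at this

end Weyl

section WeylFormula

variable {N : ℕ}

theorem coe_expFlow_one_smul_one (a : ℝ) :
    (expFlow (a • (1 : selfAdjoint (Matrix (Fin N) (Fin N) ℂ))) 1 : Matrix (Fin N) (Fin N) ℂ) =
      (Circle.exp a : ℂ) • (1 : Matrix (Fin N) (Fin N) ℂ) := by
  rw [coe_expFlow, one_smul]
  have h1 : Complex.I • ((a • (1 : selfAdjoint (Matrix (Fin N) (Fin N) ℂ)) :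
      selfAdjoint (Matrix (Fin N) (Fin N) ℂ)) : Matrix (Fin N) (Fin N) ℂ) =
      algebraMap ℂ _ ((a : ℂ) * Complex.I) := by
    rw [Algebra.algebraMap_eq_smul_one, mul_comm, ← smul_smul]
    rfl
  rw [h1, ← NormedSpace.algebraMap_exp_comm, ← Complex.exp_eq_exp_ℂ,
    Algebra.algebraMap_eq_smul_one, Circle.coe_exp]

/-- Every unitary matrix is a scalar phase times `exp (i H)` with `H` Hermitian: after a rotation
`-1` is not an eigenvalue, and the principal logarithm applies. -/
theorem exists_eq_expFlow_mul_expFlow (A : U N) :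
    ∃ H K : selfAdjoint (Matrix (Fin N) (Fin N) ℂ), A = expFlow H 1 * expFlow K 1 := by
  have hinf : ((fun a : ℝ => -(Circle.exp a : ℂ)) '' Set.Ioo 0 1).Infinite := by
    refine (Set.Ioo_infinite one_pos).image fun a ha b hb hab => ?_
    have h := neg_injective hab
    have hlt := Real.pi_gt_three
    rw [← Circle.arg_exp (x := a) (by linarith [ha.1]) (by linarith [ha.2]),
      ← Circle.arg_exp (x := b) (by linarith [hb.1]) (by linarith [hb.2])]
    exact congrArg Complex.arg h
  obtain ⟨_, ⟨a, _, rfl⟩, ha⟩ :=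
    (hinf.sdiff (Matrix.finite_spectrum (A : Matrix (Fin N) (Fin N) ℂ))).nonempty
  set E : U N := expFlow (a • 1) 1 with hE
  set B : U N := E⁻¹ * A with hB
  have hEB : (A : Matrix (Fin N) (Fin N) ℂ) =
    (Circle.exp a : ℂ) • (B : Matrix (Fin N) (Fin N) ℂ) := by
    have : A = E * B := by rw [hB, mul_inv_cancel_left]
    rw [this, Submonoid.coe_mul, hE, coe_expFlow_one_smul_one, smul_mul_assoc, one_mul]
  have hspec : (-1 : ℂ) ∉ spectrum ℂ (B : Matrix (Fin N) (Fin N) ℂ) := by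
    intro h
    apply ha
    rw [hEB]
    have := (spectrum.smul_mem_smul_iff (r := Units.mk0 (Circle.exp a : ℂ) (Circle.coe_ne_zero _))
      (s := (-1 : ℂ)) (a := (B : Matrix (Fin N) (Fin N) ℂ))).2 h
    simpa [Units.smul_def] using this
  have hlt := (Unitary.norm_sub_one_lt_two_iff B.2).2 hspec
  refine ⟨a • 1, Unitary.argSelfAdjoint B, ?_⟩
  have h2 : expFlow (Unitary.argSelfAdjoint B) 1 = B := by
    rw [expFlow, one_smul]
    exact expUnitary_argSelfAdjoint hlt
  rw [h2, ← hE, hB, mul_inv_cancel_left]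

instance instIsMulLeftInvariantWeylMeasure : (weylMeasure N).IsMulLeftInvariant := by
  constructor
  intro A
  obtain ⟨H, K, rfl⟩ := exists_eq_expFlow_mul_expFlow A
  have h : (fun B : U N => expFlow H 1 * expFlow K 1 * B) =
      (fun B => expFlow H 1 * B) ∘ (fun B => expFlow K 1 * B) := by
    funext B
    exact mul_assoc _ _ _
  rw [h, ← Measure.map_map (measurable_const_mul _) (measurable_const_mul _),
    map_expFlow_mul_weylMeasure, map_expFlow_mul_weylMeasure]

/-- **Weyl's integration formula** for `𝕌(N)`, up to the total mass of the Weyl density. -/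
theorem lintegral_haarU_of_conj_invariant {F : U N → ℝ≥0∞} (hF : Measurable F)
    (hconj : ∀ V A : U N, F (V * A * V⁻¹) = F A) :
    weylMeasure N Set.univ * ∫⁻ A, F A ∂(haarU N) =
      ∫⁻ θ : Torus N, ENNReal.ofReal (weylDensityReal θ) * F (diagU θ) := by
  rw [← smul_eq_mul, ← lintegral_smul_measure]
  have h := eq_smul_haarU_of_isMulLeftInvariant (weylMeasure N)
  rw [← h, weylMeasure, lintegral_map hF continuous_conjDiag.measurable]
  have hd : Measurable fun θ : Torus N => F (diagU θ) :=
    hF.comp continuous_diagU.measurable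
  calc ∫⁻ q, F (conjDiag q) ∂((haarU N).prod (torusMeasure N))
      = ∫⁻ q : U N × Torus N, F (diagU q.2) ∂((haarU N).prod (torusMeasure N)) := by
        refine lintegral_congr fun q => hconj _ _
    _ = ∫⁻ θ, F (diagU θ) ∂(torusMeasure N) := by
        rw [lintegral_prod_symm' (fun q : U N × Torus N => F (diagU q.2)) (hd.comp measurable_snd)]
        simp
    _ = _ := by
        rw [torusMeasure, lintegral_withDensity_eq_lintegral_mul _
          continuous_weylDensityReal.measurable.ennreal_ofReal hd]
        rfl

end WeylFormula

/-! ### Cayley coordinates on the torus -/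

/-- The angle `θ ∈ (0, 2π)` with `cot (θ / 2) = x`. -/
def cayleyAngle (x : ℝ) : ℝ := π - 2 * Real.arctan x

theorem hasDerivAt_cayleyAngle (x : ℝ) :
    HasDerivAt cayleyAngle (-(2 / (1 + x ^ 2))) x := by
  have h := ((Real.hasDerivAt_arctan x).const_mul 2).const_sub π
  refine h.congr_deriv ?_
  ring

theorem injective_cayleyAngle : Function.Injective cayleyAngle := fun x y h =>
  Real.arctan_injective (by simpa [cayleyAngle] using h)

theorem range_cayleyAngle : Set.range cayleyAngle = Set.Ioo 0 (2 * π) := by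
  ext θ
  constructor
  · rintro ⟨x, rfl⟩
    have h1 := Real.arctan_lt_pi_div_two x
    have h2 := Real.neg_pi_div_two_lt_arctan x
    constructor <;> simp only [cayleyAngle] <;> linarith
  · rintro ⟨h1, h2⟩
    refine ⟨Real.tan ((π - θ) / 2), ?_⟩
    rw [cayleyAngle, Real.arctan_tan (by linarith) (by linarith)]
    ring

theorem measurable_cayleyAngle : Measurable cayleyAngle :=
  (continuous_const.sub (continuous_const.mul Real.continuous_arctan)).measurable

/-- The density `2 / (1 + x²)` of the uniform measure on the circle in Cayley coordinates. -/
def cayleyDensity (x : ℝ) : ℝ := 2 / (1 + x ^ 2)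

theorem cayleyDensity_pos (x : ℝ) : 0 < cayleyDensity x := by unfold cayleyDensity; positivity

theorem continuous_cayleyDensity : Continuous cayleyDensity := by
  unfold cayleyDensity
  exact continuous_const.div (by fun_prop) fun x => by positivity

theorem integrable_cayleyDensity : Integrable cayleyDensity := by
  have := integrable_inv_one_add_sq.const_mul 2
  exact this

theorem measurePreserving_coe_cayleyAngle :
    MeasurePreserving (fun x => (cayleyAngle x : AddCircle (2 * π)))
      (volume.withDensity fun x => ENNReal.ofReal (cayleyDensity x)) volume := by
  have h1 := AddCircle.measurePreserving_mk (2 * π) 0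
  rw [zero_add, ← Measure.restrict_congr_set (Ioo_ae_eq_Ioc (μ := volume))] at h1
  refine h1.comp (g := (QuotientAddGroup.mk : ℝ → AddCircle (2 * π))) ⟨measurable_cayleyAngle, ?_⟩
  ext s hs
  rw [Measure.map_apply measurable_cayleyAngle hs,
    withDensity_apply _ (measurable_cayleyAngle hs), Measure.restrict_apply hs,
    ← lintegral_indicator (measurable_cayleyAngle hs)]
  have h2 := lintegral_image_eq_lintegral_abs_deriv_mul (s := Set.univ) MeasurableSet.univ
    (fun x _ => (hasDerivAt_cayleyAngle x).hasDerivWithinAt) injective_cayleyAngle.injOn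
    (s.indicator 1)
  rw [Set.image_univ, range_cayleyAngle, lintegral_indicator_one hs, Measure.restrict_apply hs,
    Measure.restrict_univ] at h2
  rw [h2]
  refine lintegral_congr fun x => ?_
  rw [abs_neg, abs_of_pos (show 0 < 2 / (1 + x ^ 2) from cayleyDensity_pos x)]
  by_cases hx : cayleyAngle x ∈ s
  · rw [Set.indicator_of_mem (show x ∈ cayleyAngle ⁻¹' s from hx), Set.indicator_of_mem hx]
    simp [cayleyDensity]
  · rw [Set.indicator_of_notMem (show x ∉ cayleyAngle ⁻¹' s from hx), Set.indicator_of_notMem hx]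
    simp

/-- A product of measures with densities has the product density. -/
theorem pi_withDensity_ofReal {ι : Type*} [Fintype ι] {f : ℝ → ℝ} (hf : Integrable f)
    (hf0 : ∀ x, 0 ≤ f x) :
    Measure.pi (fun _ : ι => (volume : Measure ℝ).withDensity fun x => ENNReal.ofReal (f x)) =
      (volume : Measure (ι → ℝ)).withDensity fun x => ENNReal.ofReal (∏ i, f (x i)) := by
  have hfin : IsFiniteMeasure ((volume : Measure ℝ).withDensity fun x => ENNReal.ofReal (f x)) :=
    isFiniteMeasure_withDensity_ofReal hf.2
  refine Measure.pi_eq fun s hs => ?_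
  rw [withDensity_apply _ (MeasurableSet.univ_pi hs), volume_pi, Measure.restrict_pi_pi,
    ← ofReal_integral_eq_lintegral_ofReal
      (Integrable.fintype_prod fun i => hf.integrableOn (s := s i))
      (Filter.Eventually.of_forall fun x => Finset.prod_nonneg fun i _ => hf0 _),
    integral_fintype_prod_eq_prod,
    ENNReal.ofReal_prod_of_nonneg fun i _ => integral_nonneg fun x => hf0 x]
  refine Finset.prod_congr rfl fun i _ => ?_
  rw [withDensity_apply _ (hs i), ofReal_integral_eq_lintegral_ofReal hf.integrableOn
    (Filter.Eventually.of_forall fun x => hf0 x)]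

section Cayley

variable {N : ℕ}

/-- The point of the torus with Cayley coordinates `x`. -/
def cayleyTorus (x : Fin N → ℝ) : Torus N := fun j => (cayleyAngle (x j) : AddCircle (2 * π))

theorem lintegral_torus_eq {g : Torus N → ℝ≥0∞} (hg : Measurable g) :
    ∫⁻ θ, g θ = ∫⁻ x : Fin N → ℝ,
      ENNReal.ofReal (∏ j, cayleyDensity (x j)) * g (cayleyTorus x) := by
  have h := measurePreserving_pi (fun _ : Fin N => (volume : Measure ℝ).withDensity
    fun x => ENNReal.ofReal (cayleyDensity x)) (fun _ => (volume : Measure (AddCircle (2 * π))))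
    (fun _ => measurePreserving_coe_cayleyAngle)
  rw [pi_withDensity_ofReal integrable_cayleyDensity
    fun x => (cayleyDensity_pos x).le] at h
  have hgm : Measurable fun x : Fin N → ℝ => g (cayleyTorus x) := hg.comp h.measurable
  rw [volume_pi, ← h.lintegral_comp hg]
  refine (lintegral_withDensity_eq_lintegral_mul _ ?_ hgm).trans ?_
  · refine Measurable.ennreal_ofReal (Finset.measurable_prod _ fun j _ => ?_)
    exact continuous_cayleyDensity.measurable.comp (measurable_pi_apply j)
  · rfl

theorem ofReal_sub_I_ne_zero (x : ℝ) : (x : ℂ) - Complex.I ≠ 0 := by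
  intro h
  simpa using congrArg Complex.im h

theorem ofReal_add_I_ne_zero (x : ℝ) : (x : ℂ) + Complex.I ≠ 0 := by
  intro h
  simpa using congrArg Complex.im h

theorem ofReal_add_I_mul_sub_I (x : ℝ) :
    ((x : ℂ) + Complex.I) * ((x : ℂ) - Complex.I) = ((1 + x ^ 2 : ℝ) : ℂ) := by
  push_cast
  linear_combination -Complex.I_sq

theorem norm_ofReal_sub_I (x : ℝ) : ‖(x : ℂ) - Complex.I‖ = √(1 + x ^ 2) := by
  rw [Complex.norm_eq_sqrt_sq_add_sq]
  simp [add_comm]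

/-- The eigenvalue with Cayley coordinate `x` is `(x + i) / (x - i)`. -/
theorem phase_cayleyTorus (x : Fin N → ℝ) (j : Fin N) :
    phase (cayleyTorus x) j = ((x j : ℂ) + Complex.I) / ((x j : ℂ) - Complex.I) := by
  set y := x j with hy
  have h1 : phase (cayleyTorus x) j = Complex.exp ((cayleyAngle y : ℂ) * Complex.I) := by
    simp [phase, cayleyTorus, AddCircle.toCircle_apply_mk, Circle.coe_exp, hy]
  have h2 : Complex.exp ((cayleyAngle y : ℂ) * Complex.I) =
      -(Complex.exp ((-Real.arctan y : ℝ) * Complex.I)) ^ 2 := by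
    rw [← Complex.exp_nat_mul, neg_eq_neg_one_mul, ← Complex.exp_pi_mul_I, ← Complex.exp_add]
    congr 1
    simp only [cayleyAngle]
    push_cast
    ring
  have h3 : Complex.exp ((-Real.arctan y : ℝ) * Complex.I) =
      (1 - y * Complex.I) / (√(1 + y ^ 2) : ℝ) := by
    rw [Complex.exp_mul_I, ← Complex.ofReal_cos, ← Complex.ofReal_sin, Real.cos_neg, Real.sin_neg,
      Real.cos_arctan, Real.sin_arctan]
    push_cast
    ring
  have h4 : ((√(1 + y ^ 2) : ℝ) : ℂ) ^ 2 = ((y : ℂ) + Complex.I) * ((y : ℂ) - Complex.I) := by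
    rw [ofReal_add_I_mul_sub_I, ← Complex.ofReal_pow, Real.sq_sqrt (by positivity)]
  rw [h1, h2, h3, div_pow, h4]
  have h5 := ofReal_sub_I_ne_zero y
  have h6 := ofReal_add_I_ne_zero y
  field_simp
  linear_combination (-1 - (y : ℂ) ^ 2) * Complex.I_sq

theorem one_sub_phase_cayleyTorus (x : Fin N → ℝ) (j : Fin N) :
    1 - phase (cayleyTorus x) j = -2 * Complex.I / ((x j : ℂ) - Complex.I) := by
  rw [phase_cayleyTorus]
  have h5 := ofReal_sub_I_ne_zero (x j)
  field_simp
  ring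

theorem norm_phase_sub_phase_sq (x : Fin N → ℝ) (a b : Fin N) :
    ‖phase (cayleyTorus x) a - phase (cayleyTorus x) b‖ ^ 2 =
      4 * (x b - x a) ^ 2 / ((1 + x a ^ 2) * (1 + x b ^ 2)) := by
  have ha := ofReal_sub_I_ne_zero (x a)
  have hb := ofReal_sub_I_ne_zero (x b)
  have h : phase (cayleyTorus x) a - phase (cayleyTorus x) b =
      2 * Complex.I * ((x b - x a : ℝ) : ℂ) /
        (((x a : ℂ) - Complex.I) * ((x b : ℂ) - Complex.I)) := by
    rw [phase_cayleyTorus, phase_cayleyTorus]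
    push_cast
    field_simp
    ring
  rw [h, norm_div, norm_mul, norm_mul, norm_mul, norm_ofReal_sub_I, norm_ofReal_sub_I,
    Complex.norm_I, Complex.norm_real, div_pow, mul_pow, mul_pow, mul_pow, Real.norm_eq_abs,
    sq_abs, Real.sq_sqrt (by positivity), Real.sq_sqrt (by positivity)]
  norm_num

end Cayley

/-! ### Products over pairs of indices -/

theorem prod_pairs {N : ℕ} {M : Type*} [CommMonoid M] (g : Fin N → Fin N → M) :
    ∏ p ∈ pairs N, g p.1 p.2 = ∏ i, ∏ j ∈ Finset.Ioi i, g i j := by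
  rw [Finset.prod_sigma']
  refine Finset.prod_bij' (fun p _ => ⟨p.1, p.2⟩) (fun p _ => (p.1, p.2)) ?_ ?_ ?_ ?_ ?_ <;>
    simp [pairs]

theorem prod_pairs_mul {N : ℕ} {M : Type*} [CommMonoid M] (g : Fin N → M) :
    ∏ p ∈ pairs N, g p.1 * g p.2 = ∏ j, g j ^ (N - 1) := by
  have h1 : ∏ p ∈ pairs N, g p.1 = ∏ j, g j ^ (N - 1 - (j : ℕ)) := by
    rw [prod_pairs (fun i _ => g i)]
    exact Finset.prod_congr rfl fun j _ => by rw [Finset.prod_const, Fin.card_Ioi]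
  have h2 : ∏ p ∈ pairs N, g p.2 = ∏ j, g j ^ (j : ℕ) := by
    rw [prod_pairs (fun _ j => g j)]
    rw [Finset.prod_comm' (t' := Finset.univ) (s' := fun j => Finset.Iio j) (by simp)]
    exact Finset.prod_congr rfl fun j _ => by rw [Finset.prod_const, Fin.card_Iio]
  rw [Finset.prod_mul_distrib, h1, h2, ← Finset.prod_mul_distrib]
  refine Finset.prod_congr rfl fun j _ => ?_
  rw [← pow_add]
  congr 1
  omega

theorem weylDensityReal_cayleyTorus {N : ℕ} (x : Fin N → ℝ) :
    weylDensityReal (cayleyTorus x) =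
      4 ^ (pairs N).card * vandermonde x ^ 2 / ∏ j, (1 + x j ^ 2) ^ (N - 1) := by
  unfold weylDensityReal vandermonde
  simp only [norm_phase_sub_phase_sq]
  rw [Finset.prod_div_distrib, Finset.prod_mul_distrib, Finset.prod_const,
    prod_pairs_mul (fun j => 1 + x j ^ 2), Finset.prod_pow, prod_pairs (fun i j => x j - x i)]

/-! ### The integrand as a class function -/

section Integrand

variable {N : ℕ}

theorem continuous_uncurry_Z : Continuous (Function.uncurry (Z : U N → ℝ → ℂ)) := by
  unfold Z Function.uncurry
  refine Continuous.matrix_det ?_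
  fun_prop

theorem measurable_deriv_at {α : Type*} [TopologicalSpace α] [MeasurableSpace α]
    [OpensMeasurableSpace α] {f : α → ℝ → ℂ} (hf : Continuous f.uncurry) (t : ℝ) :
    Measurable fun a => deriv (f a) t :=
  (measurable_deriv_with_param hf).comp (measurable_id.prodMk measurable_const)

theorem differentiable_Z (A : U N) : Differentiable ℝ (Z A) := by
  unfold Z
  simp only [det_apply, Matrix.sub_apply, Matrix.smul_apply]
  have h : Differentiable ℝ fun θ : ℝ => Complex.exp (-Complex.I * θ) :=
    ((Complex.ofRealCLM.differentiable).const_mul _).cexp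
  refine Differentiable.fun_sum fun σ _ => Differentiable.const_smul ?_ _
  refine Differentiable.fun_finsetProd fun i _ => ?_
  exact (differentiable_const _).sub (h.smul_const _)

theorem Z_conj (W A : U N) : Z (W * A * W⁻¹) = Z A := by
  funext θ
  unfold Z
  have hW : (W : Matrix (Fin N) (Fin N) ℂ) * ((W⁻¹ : U N) : Matrix (Fin N) (Fin N) ℂ) = 1 := by
    rw [← Submonoid.coe_mul, mul_inv_cancel]; rfl
  have h : (1 - Complex.exp (-Complex.I * θ) • ((W * A * W⁻¹ : U N) : Matrix (Fin N) (Fin N) ℂ)) =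
      (W : Matrix (Fin N) (Fin N) ℂ) *
        (1 - Complex.exp (-Complex.I * θ) • (A : Matrix (Fin N) (Fin N) ℂ)) *
        ((W⁻¹ : U N) : Matrix (Fin N) (Fin N) ℂ) := by
    rw [mul_sub, sub_mul, mul_one, hW, Submonoid.coe_mul, Submonoid.coe_mul, mul_smul_comm,
      smul_mul_assoc]
  rw [h, det_mul, det_mul, mul_comm, ← mul_assoc, ← det_mul]
  rw [← Submonoid.coe_mul, inv_mul_cancel]
  simp

theorem norm_V_zero (A : U N) : ‖V A 0‖ = ‖Z A 0‖ := by
  unfold V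
  rw [norm_mul, Complex.norm_exp]
  simp

/-- The phase `exp (iNπ/2 - i ∑ θ_j/2)` does not affect the modulus of the derivative. -/
theorem norm_deriv_V_zero (A : U N) :
    ‖deriv (V A) 0‖ = ‖Complex.I * N / 2 * Z A 0 + deriv (Z A) 0‖ := by
  set S := (eigenangles A).sum with hS
  have h1 : HasDerivAt (fun θ : ℝ => Complex.I * N * (((θ : ℂ) + π) / 2)
      - Complex.I * ((S : ℝ) / 2)) (Complex.I * N / 2) (0 : ℝ) := by
    have h := ((((Complex.ofRealCLM.hasDerivAt (x := (0 : ℝ))).add_const (π : ℂ)).div_const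
      2).const_mul (Complex.I * N)).sub_const (Complex.I * ((S : ℝ) / 2))
    refine h.congr_deriv ?_
    simp
    ring
  have h2 := h1.cexp.mul ((differentiable_Z A) 0).hasDerivAt
  have h3 : deriv (V A) 0 = Complex.exp (Complex.I * N * ((((0 : ℝ) : ℂ) + π) / 2)
      - Complex.I * ((S : ℝ) / 2)) * (Complex.I * N / 2 * Z A 0 + deriv (Z A) 0) := by
    rw [show deriv (V A) 0 = _ from h2.deriv]
    ring
  rw [h3, norm_mul, Complex.norm_exp]
  simp

theorem jointIntegrand_eq (s h : ℝ) (A : U N) : jointIntegrand N s h A =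
    ‖Z A 0‖ ^ (2 * s - 2 * h) * ‖Complex.I * N / 2 * Z A 0 + deriv (Z A) 0‖ ^ (2 * h) := by
  rw [jointIntegrand, norm_V_zero, norm_deriv_V_zero]

theorem measurable_jointIntegrand (s h : ℝ) : Measurable (jointIntegrand N s h) := by
  have h1 : Measurable fun A : U N => Z A 0 :=
    (continuous_uncurry_Z.comp (Continuous.prodMk_left (0 : ℝ))).measurable
  have h2 : Measurable fun A : U N => deriv (Z A) 0 := measurable_deriv_at continuous_uncurry_Z 0
  have h3 : Measurable fun A : U N => ‖Z A 0‖ ^ (2 * s - 2 * h) := h1.norm.pow_const _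
  have h4 : Measurable fun A : U N =>
      ‖Complex.I * N / 2 * Z A 0 + deriv (Z A) 0‖ ^ (2 * h) :=
    (((measurable_const.mul h1).add h2).norm).pow_const _
  rw [funext (jointIntegrand_eq (N := N) s h)]
  exact h3.mul h4

theorem jointIntegrand_conj (s h : ℝ) (W A : U N) :
    jointIntegrand N s h (W * A * W⁻¹) = jointIntegrand N s h A := by
  rw [jointIntegrand_eq, jointIntegrand_eq, Z_conj]

theorem jointIntegrand_nonneg (s h : ℝ) (A : U N) : 0 ≤ jointIntegrand N s h A := by
  unfold jointIntegrand
  positivity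

theorem Z_diagU (θ : Torus N) (t : ℝ) :
    Z (diagU θ) t = ∏ j, (1 - Complex.exp (-Complex.I * t) * phase θ j) := by
  unfold Z
  rw [coe_diagU, ← diagonal_one, ← diagonal_smul, diagonal_sub, det_diagonal]
  rfl

/-- In Cayley coordinates `|Z(0)| = ∏ 2 / √(1 + x_j²)`. -/
theorem norm_Z_cayley (x : Fin N → ℝ) :
    ‖Z (diagU (cayleyTorus x)) 0‖ = ∏ j, (2 / √(1 + x j ^ 2)) := by
  rw [Z_diagU, norm_prod]
  refine Finset.prod_congr rfl fun j _ => ?_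
  rw [Complex.ofReal_zero, mul_zero, Complex.exp_zero, one_mul, one_sub_phase_cayleyTorus,
    norm_div, norm_ofReal_sub_I]
  simp

/-- In Cayley coordinates the logarithmic derivative of `V` at `0` is `-(∑ x_j) / 2`. -/
theorem deriv_Z_cayley (x : Fin N → ℝ) :
    Complex.I * N / 2 * Z (diagU (cayleyTorus x)) 0 + deriv (Z (diagU (cayleyTorus x))) 0 =
      -(((∑ j, x j : ℝ) : ℂ) / 2) * Z (diagU (cayleyTorus x)) 0 := by
  set z := phase (cayleyTorus x) with hz
  have hd : ∀ j, HasDerivAt (fun t : ℝ => 1 - Complex.exp (-Complex.I * t) * z j)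
      (Complex.I * z j) (0 : ℝ) := by
    intro j
    have h := ((((Complex.ofRealCLM.hasDerivAt (x := (0 : ℝ))).const_mul
      (-Complex.I)).cexp).mul_const (z j)).const_sub 1
    refine h.congr_deriv ?_
    simp
  have hP := HasDerivAt.fun_finsetProd (u := Finset.univ)
    (f := fun j (t : ℝ) => 1 - Complex.exp (-Complex.I * t) * z j) fun j _ => hd j
  have hZ : Z (diagU (cayleyTorus x)) =
      fun t : ℝ => ∏ j, (1 - Complex.exp (-Complex.I * t) * z j) := funext (Z_diagU _)
  rw [hZ, hP.deriv]
  simp only [Complex.ofReal_zero, mul_zero, Complex.exp_zero, one_mul, smul_eq_mul]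
  have hone : ∀ j, 1 - z j ≠ 0 := by
    intro j
    rw [hz, one_sub_phase_cayleyTorus]
    exact div_ne_zero (by simp) (ofReal_sub_I_ne_zero _)
  have hterm : ∀ j, (∏ i ∈ Finset.univ.erase j, (1 - z i)) * (Complex.I * z j) =
      (-(x j : ℂ) / 2 - Complex.I / 2) * ∏ i, (1 - z i) := by
    intro j
    rw [← Finset.mul_prod_erase _ _ (Finset.mem_univ j)]
    have h1 : Complex.I * z j = (-(x j : ℂ) / 2 - Complex.I / 2) * (1 - z j) := by
      rw [hz, one_sub_phase_cayleyTorus, phase_cayleyTorus]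
      have := ofReal_sub_I_ne_zero (x j)
      field_simp
      ring
    rw [h1]
    ring
  rw [Finset.sum_congr rfl fun j _ => hterm j, ← Finset.sum_mul, Finset.sum_sub_distrib,
    Finset.sum_const, Finset.card_univ, Fintype.card_fin, ← Finset.sum_div, Finset.sum_neg_distrib]
  push_cast
  rw [nsmul_eq_mul]
  ring

theorem jointIntegrand_cayley (s h : ℝ) (x : Fin N → ℝ) :
    jointIntegrand N s h (diagU (cayleyTorus x)) =
      2 ^ (2 * s * N) * (2 : ℝ) ^ (-2 * h) * (∏ j, 1 / (1 + x j ^ 2) ^ s) *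
        |∑ j, x j| ^ (2 * h) := by
  rw [jointIntegrand_eq, deriv_Z_cayley, norm_mul, norm_neg, norm_div, Complex.norm_real,
    Real.norm_eq_abs, norm_Z_cayley]
  set P := ∏ j, (2 / √(1 + x j ^ 2)) with hP
  have hPpos : 0 < P := Finset.prod_pos fun j _ => by positivity
  have h1 : P ^ (2 * s) = 2 ^ (2 * s * N) * ∏ j, 1 / (1 + x j ^ 2) ^ s := by
    rw [hP, ← Real.finsetProd_rpow _ _ fun j _ => by positivity]
    have h2 : ∀ j, (2 / √(1 + x j ^ 2)) ^ (2 * s) = 2 ^ (2 * s) * (1 / (1 + x j ^ 2) ^ s) := by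
      intro j
      rw [Real.div_rpow (by norm_num) (by positivity), Real.rpow_mul (Real.sqrt_nonneg _) 2 s,
        Real.rpow_two, Real.sq_sqrt (by positivity)]
      ring
    rw [Finset.prod_congr rfl fun j _ => h2 j, Finset.prod_mul_distrib, Finset.prod_const,
      Finset.card_univ, Fintype.card_fin, ← Real.rpow_natCast, ← Real.rpow_mul (by norm_num)]
  have h3 : ‖(2 : ℂ)‖ = 2 := by simp
  rw [h3, Real.mul_rpow (by positivity) hPpos.le, Real.div_rpow (abs_nonneg _) (by norm_num),
    mul_left_comm, ← Real.rpow_add hPpos, sub_add_cancel, h1, neg_mul, Real.rpow_neg (by norm_num)]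
  ring

end Integrand

/-! ### Cauchy beta integrals -/

/-- The weight `(1 + x²)^{-(s+1)}`. -/
def cauchyWeight (s x : ℝ) : ℝ := (1 + x ^ 2) ^ (-(s + 1))

theorem cauchyWeight_pos (s x : ℝ) : 0 < cauchyWeight s x :=
  Real.rpow_pos_of_pos (by positivity) _

theorem continuous_cauchyWeight (s : ℝ) : Continuous (cauchyWeight s) := by
  unfold cauchyWeight
  exact Continuous.rpow_const (by fun_prop) fun x => Or.inl (by positivity)

theorem integrable_cauchyWeight {s : ℝ} (hs : -1 / 2 < s) : Integrable (cauchyWeight s) := by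
  have h := integrable_rpow_neg_one_add_norm_sq (E := ℝ) (μ := volume) (r := 2 * (s + 1))
    (by rw [Module.finrank_self]; push_cast; linarith)
  refine h.congr (Filter.Eventually.of_forall fun x => ?_)
  simp only [cauchyWeight, Real.norm_eq_abs, sq_abs]
  congr 1
  ring

theorem lintegral_rpow_mul_exp {a r : ℝ} (ha : 0 < a) (hr : 0 < r) :
    ∫⁻ t in Set.Ioi (0 : ℝ), ENNReal.ofReal (t ^ (a - 1) * Real.exp (-(r * t))) =
      ENNReal.ofReal ((1 / r) ^ a * Real.Gamma a) := by
  have h := Real.integral_rpow_mul_exp_neg_mul_Ioi ha hr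
  have hne : (1 / r) ^ a * Real.Gamma a ≠ 0 :=
    (mul_pos (Real.rpow_pos_of_pos (by positivity) _) (Real.Gamma_pos_of_pos ha)).ne'
  rw [← h, ofReal_integral_eq_lintegral_ofReal]
  · exact Integrable.of_integral_ne_zero (by rw [h]; exact hne)
  · filter_upwards [ae_restrict_mem measurableSet_Ioi] with t ht
    have : 0 < t := ht
    positivity

/-- The Gamma integral represents `(1 + x²)^{-(s+1)}` as a mixture of Gaussians. -/
theorem integral_cauchyWeight {s : ℝ} (hs : -1 / 2 < s) :
    ∫ x, cauchyWeight s x =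
      2 ^ (-2 * s) * π * (Real.Gamma (2 * s + 1) / Real.Gamma (s + 1) ^ 2) := by
  have hG1 : 0 < Real.Gamma (s + 1) := Real.Gamma_pos_of_pos (by linarith)
  have hG2 : 0 < Real.Gamma (s + 1 / 2) := Real.Gamma_pos_of_pos (by linarith)
  have hx : ∀ x : ℝ, ∫⁻ t in Set.Ioi (0 : ℝ),
      ENNReal.ofReal (t ^ s * Real.exp (-((1 + x ^ 2) * t))) =
      ENNReal.ofReal (Real.Gamma (s + 1) * cauchyWeight s x) := by
    intro x
    have h := lintegral_rpow_mul_exp (a := s + 1) (r := 1 + x ^ 2) (by linarith) (by positivity)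
    rw [add_sub_cancel_right] at h
    rw [h, one_div, Real.inv_rpow (by positivity), cauchyWeight, Real.rpow_neg (by positivity),
      mul_comm]
  have ht : ∀ t ∈ Set.Ioi (0 : ℝ),
      ∫⁻ x : ℝ, ENNReal.ofReal (t ^ s * Real.exp (-((1 + x ^ 2) * t))) =
      ENNReal.ofReal √π * ENNReal.ofReal (t ^ (s + 1 / 2 - 1) * Real.exp (-(1 * t))) := by
    intro t ht
    have ht : 0 < t := ht
    have hsplit : ∀ x : ℝ, t ^ s * Real.exp (-((1 + x ^ 2) * t)) =
        (t ^ s * Real.exp (-t)) * Real.exp (-t * x ^ 2) := by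
      intro x
      rw [mul_assoc, ← Real.exp_add]
      ring_nf
    simp only [hsplit]
    rw [← ofReal_integral_eq_lintegral_ofReal ((integrable_exp_neg_mul_sq ht).const_mul _)
      (Filter.Eventually.of_forall fun x => by positivity), integral_const_mul, integral_gaussian,
      ← ENNReal.ofReal_mul (Real.sqrt_nonneg _)]
    congr 1
    rw [Real.sqrt_div Real.pi_pos.le, show s + 1 / 2 - 1 = s - 1 / 2 by ring,
      Real.rpow_sub ht, ← Real.sqrt_eq_rpow, one_mul]
    ring
  have hmeas : Measurable (Function.uncurry fun (x t : ℝ) =>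
      ENNReal.ofReal (t ^ s * Real.exp (-((1 + x ^ 2) * t)))) := by
    unfold Function.uncurry
    fun_prop
  have hswap := lintegral_lintegral_swap (μ := (volume : Measure ℝ))
    (ν := volume.restrict (Set.Ioi (0 : ℝ))) hmeas.aemeasurable
  simp only [hx] at hswap
  rw [setLIntegral_congr_fun measurableSet_Ioi ht, lintegral_const_mul _ (by fun_prop),
    lintegral_rpow_mul_exp (by linarith) one_pos, ← ENNReal.ofReal_mul (Real.sqrt_nonneg _),
    ← ofReal_integral_eq_lintegral_ofReal ((integrable_cauchyWeight hs).const_mul _)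
      (Filter.Eventually.of_forall fun x => (mul_pos hG1 (cauchyWeight_pos s x)).le),
    integral_const_mul, ENNReal.ofReal_eq_ofReal_iff
      (mul_nonneg hG1.le (integral_nonneg fun x => (cauchyWeight_pos s x).le)) (by positivity),
    div_one, Real.one_rpow, one_mul] at hswap
  have hdup := Real.Gamma_mul_Gamma_add_half (s + 1 / 2)
  rw [show s + 1 / 2 + 1 / 2 = s + 1 by ring, show 2 * (s + 1 / 2) = 2 * s + 1 by ring,
    show 1 - (2 * s + 1) = -2 * s by ring] at hdup
  have hpi : √π * √π = π := Real.mul_self_sqrt Real.pi_pos.le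
  rw [mul_div_assoc', eq_div_iff (by positivity)]
  calc (∫ x, cauchyWeight s x) * Real.Gamma (s + 1) ^ 2
      = (Real.Gamma (s + 1) * ∫ x, cauchyWeight s x) * Real.Gamma (s + 1) := by ring
    _ = √π * (Real.Gamma (s + 1 / 2) * Real.Gamma (s + 1)) := by rw [hswap]; ring
    _ = _ := by
      rw [hdup]
      linear_combination (Real.Gamma (2 * s + 1) * 2 ^ (-2 * s)) * hpi

/-- The Cauchy beta integrals `∫ (1 + x²)^{-(s+1)} (x + i)^{-k} (x - i)^{-l} dx`. -/
def cauchyBeta (s : ℝ) (k l : ℕ) : ℂ :=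
  ∫ x : ℝ, (cauchyWeight s x : ℂ) * (((x : ℂ) + Complex.I)⁻¹ ^ k * ((x : ℂ) - Complex.I)⁻¹ ^ l)

theorem norm_ofReal_add_I (x : ℝ) : ‖(x : ℂ) + Complex.I‖ = √(1 + x ^ 2) := by
  rw [Complex.norm_eq_sqrt_sq_add_sq]
  simp [add_comm]

theorem continuous_cauchyBeta_integrand (s : ℝ) (k l : ℕ) : Continuous fun x : ℝ =>
    (cauchyWeight s x : ℂ) * (((x : ℂ) + Complex.I)⁻¹ ^ k * ((x : ℂ) - Complex.I)⁻¹ ^ l) := by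
  have h1 : Continuous fun x : ℝ => ((x : ℂ) + Complex.I)⁻¹ :=
    Continuous.inv₀ (by fun_prop) ofReal_add_I_ne_zero
  have h2 : Continuous fun x : ℝ => ((x : ℂ) - Complex.I)⁻¹ :=
    Continuous.inv₀ (by fun_prop) ofReal_sub_I_ne_zero
  have := continuous_cauchyWeight s
  fun_prop

theorem norm_inv_pow_mul_inv_pow_le (x : ℝ) (k l : ℕ) :
    ‖((x : ℂ) + Complex.I)⁻¹ ^ k * ((x : ℂ) - Complex.I)⁻¹ ^ l‖ ≤ 1 := by
  have h : (√(1 + x ^ 2))⁻¹ ≤ 1 :=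
    inv_le_one_of_one_le₀ (Real.one_le_sqrt.2 (by nlinarith [sq_nonneg x]))
  rw [norm_mul, norm_pow, norm_pow, norm_inv, norm_inv, norm_ofReal_add_I, norm_ofReal_sub_I]
  exact mul_le_one₀ (pow_le_one₀ (by positivity) h) (by positivity)
    (pow_le_one₀ (by positivity) h)

theorem integrable_cauchyBeta_integrand {s : ℝ} (hs : -1 / 2 < s) (k l : ℕ) :
    Integrable fun x : ℝ => (cauchyWeight s x : ℂ) *
      (((x : ℂ) + Complex.I)⁻¹ ^ k * ((x : ℂ) - Complex.I)⁻¹ ^ l) := by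
  refine (integrable_cauchyWeight hs).mono'
    (continuous_cauchyBeta_integrand s k l).aestronglyMeasurable
    (Filter.Eventually.of_forall fun x => ?_)
  rw [norm_mul, Complex.norm_real, Real.norm_of_nonneg (cauchyWeight_pos s x).le]
  exact mul_le_of_le_one_right (cauchyWeight_pos s x).le (norm_inv_pow_mul_inv_pow_le x k l)

theorem hasDerivAt_cauchyWeight (s x : ℝ) :
    HasDerivAt (cauchyWeight s) (-(s + 1) * (2 * x / (1 + x ^ 2)) * cauchyWeight s x) x := by
  have hpos : 0 < 1 + x ^ 2 := by positivity
  have h1 : HasDerivAt (fun x : ℝ => 1 + x ^ 2) (2 * x) x := by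
    simpa using ((hasDerivAt_id x).pow 2).const_add 1
  refine (h1.rpow_const (p := -(s + 1)) (Or.inl hpos.ne')).congr_deriv ?_
  rw [Real.rpow_sub_one hpos.ne', cauchyWeight]
  ring

/-- The recursion in the second exponent, from integrating the derivative of
`(1 + x²)^{-(s+1)} (x + i)^{1-k} (x - i)^{-l}`. -/
theorem cauchyBeta_succ_right {s : ℝ} (hs : -1 / 2 < s) (k l : ℕ) :
    cauchyBeta s k (l + 1) =
      Complex.I / 2 * ((2 * s + 1 + k + l) / (s + 1 + l)) * cauchyBeta s k l := by
  set g : ℕ → ℝ → ℂ := fun l x => (cauchyWeight s x : ℂ) *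
    (((x : ℂ) + Complex.I)⁻¹ ^ k * ((x : ℂ) - Complex.I)⁻¹ ^ l) with hg
  have hgi : ∀ l, Integrable (g l) := fun l => integrable_cauchyBeta_integrand hs k l
  have hderiv : ∀ x : ℝ, HasDerivAt (fun x : ℝ => ((x : ℂ) + Complex.I) * g l x)
      (-(2 * s + 1 + k + l) * g l x + -(2 * Complex.I * (s + 1 + l)) * g (l + 1) x) x := by
    intro x
    have hu := ofReal_add_I_ne_zero x
    have hv := ofReal_sub_I_ne_zero x
    have h1 : HasDerivAt (fun x : ℝ => (x : ℂ) + Complex.I) 1 x :=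
      (Complex.ofRealCLM.hasDerivAt (x := x)).add_const _
    have h2 : HasDerivAt (fun x : ℝ => (x : ℂ) - Complex.I) 1 x :=
      (Complex.ofRealCLM.hasDerivAt (x := x)).sub_const _
    have hw := (hasDerivAt_cauchyWeight s x).ofReal_comp
    refine (h1.fun_mul (hw.fun_mul (((h1.fun_inv hu).fun_pow k).fun_mul
      ((h2.fun_inv hv).fun_pow l)))).congr_deriv ?_
    have hq : ((2 * x / (1 + x ^ 2) : ℝ) : ℂ) =
        ((x : ℂ) + Complex.I)⁻¹ + ((x : ℂ) - Complex.I)⁻¹ := by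
      rw [Complex.ofReal_div, ← ofReal_add_I_mul_sub_I]
      push_cast
      field_simp
      ring
    have hk : (k : ℂ) * ((x : ℂ) + Complex.I)⁻¹ ^ (k - 1) =
        k * (((x : ℂ) + Complex.I)⁻¹ ^ k * ((x : ℂ) + Complex.I)) := by
      rcases k with _ | k
      · simp
      · rw [Nat.add_sub_cancel, pow_succ]; field_simp
    have hl : (l : ℂ) * ((x : ℂ) - Complex.I)⁻¹ ^ (l - 1) =
        l * (((x : ℂ) - Complex.I)⁻¹ ^ l * ((x : ℂ) - Complex.I)) := by
      rcases l with _ | l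
      · simp
      · rw [Nat.add_sub_cancel, pow_succ]; field_simp
    simp only [hg]
    rw [hk, hl, Complex.ofReal_mul, Complex.ofReal_mul, hq, pow_succ ((x : ℂ) - Complex.I)⁻¹ l]
    generalize ((x : ℂ) + Complex.I)⁻¹ ^ k = a
    generalize ((x : ℂ) - Complex.I)⁻¹ ^ l = b
    push_cast
    field_simp
    ring
  have hlim : Filter.Tendsto (fun x : ℝ => (1 + x ^ 2) ^ (-(s + 1 / 2)))
      (Filter.cocompact ℝ) (nhds 0) := by
    have h1 : Filter.Tendsto (fun x : ℝ => 1 + x ^ 2) (Filter.cocompact ℝ) Filter.atTop := by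
      refine Filter.tendsto_atTop_add_const_left _ _ ?_
      have := (tendsto_norm_cocompact_atTop (E := ℝ)).comp Filter.tendsto_id
      have h2 := (Filter.tendsto_pow_atTop (α := ℝ) (n := 2) two_ne_zero).comp this
      simpa [Function.comp_def] using h2
    exact (tendsto_rpow_neg_atTop (by linarith)).comp h1
  have hzero : Filter.Tendsto (fun x : ℝ => ((x : ℂ) + Complex.I) * g l x)
      (Filter.cocompact ℝ) (nhds 0) := by
    refine squeeze_zero_norm (fun x => ?_) hlim
    rw [norm_mul, norm_ofReal_add_I, hg, norm_mul, Complex.norm_real,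
      Real.norm_of_nonneg (cauchyWeight_pos s x).le]
    have hpos : 0 < 1 + x ^ 2 := by positivity
    have h3 : √(1 + x ^ 2) * cauchyWeight s x = (1 + x ^ 2) ^ (-(s + 1 / 2)) := by
      rw [cauchyWeight, Real.sqrt_eq_rpow, ← Real.rpow_add hpos]
      congr 1
      ring
    rw [← h3, ← mul_assoc]
    exact mul_le_of_le_one_right (mul_nonneg (Real.sqrt_nonneg _) (cauchyWeight_pos s x).le)
      (norm_inv_pow_mul_inv_pow_le x k l)
  have hint := integral_of_hasDerivAt_of_tendsto hderiv
    (((hgi l).const_mul _).add ((hgi (l + 1)).const_mul _))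
    (hzero.mono_left atBot_le_cocompact) (hzero.mono_left atTop_le_cocompact)
  rw [integral_add ((hgi l).const_mul _) ((hgi (l + 1)).const_mul _), integral_const_mul,
    integral_const_mul, sub_zero] at hint
  change _ * cauchyBeta s k l + _ * cauchyBeta s k (l + 1) = 0 at hint
  have hne : (s : ℂ) + 1 + l ≠ 0 := by
    have : ((s + 1 + l : ℝ) : ℂ) ≠ 0 := by
      rw [Complex.ofReal_ne_zero]
      have : (0 : ℝ) ≤ l := Nat.cast_nonneg l
      linarith
    simpa using this
  field_simp
  linear_combination (Complex.I) * hint +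
    (2 * (s + 1 + l) * cauchyBeta s k (l + 1)) * Complex.I_sq

theorem conj_cauchyBeta (s : ℝ) (k l : ℕ) :
    (starRingEnd ℂ) (cauchyBeta s k l) = cauchyBeta s l k := by
  unfold cauchyBeta
  rw [← integral_conj]
  refine integral_congr_ae (Filter.Eventually.of_forall fun x => ?_)
  simp only [map_mul, map_pow, map_inv₀, map_add, map_sub, Complex.conj_ofReal, Complex.conj_I]
  ring

theorem cauchyBeta_succ_left {s : ℝ} (hs : -1 / 2 < s) (k l : ℕ) :
    cauchyBeta s (k + 1) l =
      -Complex.I / 2 * ((2 * s + 1 + k + l) / (s + 1 + k)) * cauchyBeta s k l := by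
  rw [← conj_cauchyBeta, cauchyBeta_succ_right hs, map_mul, conj_cauchyBeta]
  congr 1
  simp only [map_mul, map_div₀, map_add, Complex.conj_ofReal, Complex.conj_I, map_natCast, map_one,
    map_ofNat]
  ring

theorem cauchyBeta_zero {s : ℝ} (hs : -1 / 2 < s) : cauchyBeta s 0 0 =
    ((2 ^ (-2 * s) * π * (Real.Gamma (2 * s + 1) / Real.Gamma (s + 1) ^ 2) : ℝ) : ℂ) := by
  rw [← integral_cauchyWeight hs]
  simp [cauchyBeta, integral_complex_ofReal]

/-- Cauchy's beta integral in closed form. -/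
theorem cauchyBeta_eq {s : ℝ} (hs : -1 / 2 < s) (k l : ℕ) : cauchyBeta s k l =
    ((2 ^ (-2 * s) * π : ℝ) : ℂ) * (-Complex.I / 2) ^ k * (Complex.I / 2) ^ l *
      ((Real.Gamma (2 * s + 1 + k + l) /
        (Real.Gamma (s + 1 + k) * Real.Gamma (s + 1 + l)) : ℝ) : ℂ) := by
  have hG : ∀ m : ℕ, Real.Gamma (s + 1 + (m + 1 : ℕ)) = (s + 1 + m) * Real.Gamma (s + 1 + m) := by
    intro m
    have hm : (0 : ℝ) ≤ m := Nat.cast_nonneg m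
    rw [← Real.Gamma_add_one (by linarith)]
    push_cast
    ring_nf
  have hpos : ∀ m : ℕ, 0 < s + 1 + m := fun m => by
    have hm : (0 : ℝ) ≤ m := Nat.cast_nonneg m
    linarith
  have hne : ∀ m : ℕ, (s : ℂ) + 1 + m ≠ 0 := fun m => by
    have := (hpos m).ne'
    exact_mod_cast this
  have hGne : ∀ m : ℕ, ((Real.Gamma (s + 1 + m) : ℝ) : ℂ) ≠ 0 := fun m =>
    Complex.ofReal_ne_zero.2 (Real.Gamma_pos_of_pos (hpos m)).ne'
  induction l with
  | zero =>
    induction k with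
    | zero =>
      rw [cauchyBeta_zero hs]
      simp [sq]
    | succ k ih =>
      have hk : (0 : ℝ) ≤ k := Nat.cast_nonneg k
      have h2 : Real.Gamma (2 * s + 1 + (k + 1 : ℕ) + (0 : ℕ)) =
          (2 * s + 1 + k) * Real.Gamma (2 * s + 1 + k + (0 : ℕ)) := by
        rw [Nat.cast_zero, add_zero, add_zero, ← Real.Gamma_add_one (by linarith)]
        push_cast
        ring_nf
      rw [cauchyBeta_succ_left hs, ih, h2, hG k]
      have h3 := hne k
      have h4 := hGne k
      have h5 := hGne 0
      push_cast at h5 ⊢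
      field_simp
      ring
  | succ l ih =>
    have hk : (0 : ℝ) ≤ k := Nat.cast_nonneg k
    have hl : (0 : ℝ) ≤ l := Nat.cast_nonneg l
    have h2 : Real.Gamma (2 * s + 1 + k + (l + 1 : ℕ)) =
        (2 * s + 1 + k + l) * Real.Gamma (2 * s + 1 + k + l) := by
      rw [← Real.Gamma_add_one (by linarith)]
      push_cast
      ring_nf
    rw [cauchyBeta_succ_right hs, ih, h2, hG l]
    have h3 := hne l
    have h4 := hGne k
    have h5 := hGne l
    push_cast
    field_simp
    ring

/-! ### The total mass -/

/-- **Andréief's identity** for the integral of a product of two determinants. -/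
theorem integral_det_mul_det {N : ℕ} (f g : Fin N → ℝ → ℂ)
    (hfg : ∀ k l, Integrable fun x => f k x * g l x) :
    Integrable (fun x : Fin N → ℝ => (Matrix.of fun k j => f k (x j)).det *
      (Matrix.of fun k j => g k (x j)).det) ∧
    ∫ x : Fin N → ℝ, (Matrix.of fun k j => f k (x j)).det *
      (Matrix.of fun k j => g k (x j)).det =
      N.factorial * (Matrix.of fun k l => ∫ x, f k x * g l x).det := by
  set J : Matrix (Fin N) (Fin N) ℂ := Matrix.of fun k l => ∫ x, f k x * g l x with hJ
  have hexp : ∀ x : Fin N → ℝ, (Matrix.of fun k j => f k (x j)).det *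
      (Matrix.of fun k j => g k (x j)).det =
      ∑ σ : Equiv.Perm (Fin N), ∑ τ : Equiv.Perm (Fin N),
        ((Equiv.Perm.sign σ : ℤ) : ℂ) * ((Equiv.Perm.sign τ : ℤ) : ℂ) *
          ∏ j, (f (σ j) (x j) * g (τ j) (x j)) := by
    intro x
    rw [det_apply', det_apply', Finset.sum_mul_sum]
    refine Finset.sum_congr rfl fun σ _ => Finset.sum_congr rfl fun τ _ => ?_
    simp only [Matrix.of_apply, Finset.prod_mul_distrib]
    ring
  have hint : ∀ σ τ : Equiv.Perm (Fin N), Integrable fun x : Fin N → ℝ =>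
      ∏ j, (f (σ j) (x j) * g (τ j) (x j)) := fun σ τ =>
    Integrable.fintype_prod (f := fun j x => f (σ j) x * g (τ j) x) fun j => hfg _ _
  simp only [hexp]
  refine ⟨integrable_finsetSum _ fun σ _ => integrable_finsetSum _ fun τ _ =>
    (hint σ τ).const_mul _, ?_⟩
  rw [integral_finsetSum _ fun σ _ => integrable_finsetSum _ fun τ _ => (hint σ τ).const_mul _]
  have hσ : ∀ σ : Equiv.Perm (Fin N), ∫ x : Fin N → ℝ, ∑ τ : Equiv.Perm (Fin N),
        ((Equiv.Perm.sign σ : ℤ) : ℂ) * ((Equiv.Perm.sign τ : ℤ) : ℂ) *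
          ∏ j, (f (σ j) (x j) * g (τ j) (x j)) = J.det := by
    intro σ
    rw [integral_finsetSum _ fun τ _ => (hint σ τ).const_mul _]
    have h1 : ∀ τ : Equiv.Perm (Fin N), ∫ x : Fin N → ℝ,
        ((Equiv.Perm.sign σ : ℤ) : ℂ) * ((Equiv.Perm.sign τ : ℤ) : ℂ) *
          ∏ j, (f (σ j) (x j) * g (τ j) (x j)) =
        ((Equiv.Perm.sign σ : ℤ) : ℂ) * (((Equiv.Perm.sign τ : ℤ) : ℂ) *
          ∏ j, (J.submatrix σ id)ᵀ (τ j) j) := by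
      intro τ
      rw [integral_const_mul, mul_assoc,
        integral_fintype_prod_volume_eq_prod fun j x => f (σ j) x * g (τ j) x]
      rfl
    rw [Finset.sum_congr rfl fun τ _ => h1 τ, ← Finset.mul_sum, ← det_apply', det_transpose,
      det_permute, ← mul_assoc, ← Int.cast_mul, ← Units.val_mul, Int.units_mul_self]
    simp
  rw [Finset.sum_congr rfl fun σ _ => hσ σ, Finset.sum_const, Finset.card_univ,
    Fintype.card_perm, Fintype.card_fin, nsmul_eq_mul]

theorem prod_factorial_eq_det_vandermonde (N : ℕ) :
    barnesGSucc N = (Matrix.vandermonde fun i : Fin N => ((i : ℕ) : ℝ)).det := by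
  rcases N with _ | n
  · simp [barnesGSucc]
  · rw [det_vandermonde_id_eq_superFactorial, barnesGSucc, ← Nat.prod_range_succ_factorial]
    push_cast
    rfl

theorem Gamma_add_natCast {c : ℝ} (hc : 0 < c) (k : ℕ) :
    Real.Gamma (c + k) = (ascPochhammer ℝ k).eval c * Real.Gamma c := by
  induction k with
  | zero => simp
  | succ k ih =>
    have hk : (0 : ℝ) ≤ k := Nat.cast_nonneg k
    rw [Nat.cast_succ, ← add_assoc, Real.Gamma_add_one (by linarith), ih, ascPochhammer_succ_eval]
    ring

/-- The Hankel determinant of the Gamma function: after `Γ (c + l)` is pulled out of column `l`, the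
entries are values of the monic polynomials `ascPochhammer ℝ k`, and the determinant is a
Vandermonde determinant. -/
theorem det_Gamma {c : ℝ} (hc : 0 < c) (N : ℕ) :
    (Matrix.of fun k l : Fin N => Real.Gamma (c + (k : ℕ) + (l : ℕ))).det =
      (∏ l ∈ Finset.range N, Real.Gamma (c + l)) * barnesGSucc N := by
  have h1 : (Matrix.of fun k l : Fin N => Real.Gamma (c + (k : ℕ) + (l : ℕ))) =
      Matrix.of fun k l : Fin N => Real.Gamma (c + (l : ℕ)) *
        (Matrix.of fun l k : Fin N => (ascPochhammer ℝ k).eval (c + (l : ℕ)))ᵀ k l := by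
    ext k l
    have hl : (0 : ℝ) ≤ ((l : ℕ) : ℝ) := Nat.cast_nonneg _
    simp only [Matrix.of_apply, transpose_apply]
    rw [add_right_comm, Gamma_add_natCast (by linarith), mul_comm]
  rw [h1, det_mul_row, det_transpose, ← det_eval_matrixOfPolynomials_eq_det_vandermonde
    (fun l : Fin N => c + ((l : ℕ) : ℝ)) (fun k => ascPochhammer ℝ k)
    (fun k => ascPochhammer_natDegree ℝ k) (fun k => monic_ascPochhammer ℝ k),
    prod_factorial_eq_det_vandermonde, det_vandermonde, det_vandermonde,
    Fin.prod_univ_eq_prod_range (fun l => Real.Gamma (c + l)) N]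
  simp only [add_sub_add_left_eq_sub]

/-- The closed form of the Cauchy beta integrals reduces their determinant to that of the Gamma
function. -/
theorem det_cauchyBeta {s : ℝ} (hs : -1 / 2 < s) (N : ℕ) :
    (Matrix.of fun k l : Fin N => cauchyBeta s k l).det = ((huaPickrellConst N s : ℝ) : ℂ) := by
  set C : ℂ := ((2 ^ (-2 * s) * π : ℝ) : ℂ) with hC
  set a : ℕ → ℂ := fun k => (-Complex.I / 2) ^ k / (Real.Gamma (s + 1 + k) : ℂ) with ha
  set b : ℕ → ℂ := fun l => (Complex.I / 2) ^ l / (Real.Gamma (s + 1 + l) : ℂ) with hb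
  have h1 : (Matrix.of fun k l : Fin N => cauchyBeta s k l) =
      Matrix.of fun k l : Fin N => b l * (Matrix.of fun k l : Fin N => (C * a k) *
        ((Matrix.of fun k l : Fin N => Real.Gamma (2 * s + 1 + (k : ℕ) + (l : ℕ))).map
          (algebraMap ℝ ℂ)) k l) k l := by
    ext k l
    simp only [Matrix.of_apply, Matrix.map_apply, cauchyBeta_eq hs, ha, hb, ← hC]
    push_cast
    rw [Complex.coe_algebraMap]
    ring
  have h2 : ∀ k : ℕ, a k * b k = (((1 / 4 : ℝ) ^ k / Real.Gamma (s + 1 + k) ^ 2 : ℝ) : ℂ) := by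
    intro k
    have h3 : (-Complex.I / 2) ^ k * (Complex.I / 2) ^ k = (1 / 4 : ℂ) ^ k := by
      rw [← mul_pow]
      congr 1
      linear_combination (-1 / 4 : ℂ) * Complex.I_sq
    simp only [ha, hb]
    push_cast
    rw [← h3]
    ring
  have h4 : ∀ n : ℕ, (∏ k ∈ Finset.range n, (1 / 4 : ℝ) ^ k) * 2 ^ n ^ 2 = 2 ^ n := by
    intro n
    induction n with
    | zero => simp
    | succ n ih =>
      rw [Finset.prod_range_succ]
      have h5 : (2 : ℝ) ^ (n + 1) ^ 2 = 2 ^ n ^ 2 * (4 ^ n * 2) := by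
        rw [show (4 : ℝ) = 2 ^ 2 by norm_num, ← pow_mul, ← pow_succ, ← pow_add]
        congr 1
        ring
      have h6 : (1 / 4 : ℝ) ^ n * 4 ^ n = 1 := by rw [← mul_pow]; norm_num
      rw [h5, pow_succ]
      linear_combination ((1 / 4 : ℝ) ^ n * 4 ^ n * 2) * ih + (2 * 2 ^ n : ℝ) * h6
  have h7 : ∏ j ∈ Finset.Icc 1 N,
      Real.Gamma (2 * s + N - j + 1) / Real.Gamma (s + N - j + 1) ^ 2 =
      ∏ k ∈ Finset.range N, Real.Gamma (2 * s + 1 + k) / Real.Gamma (s + 1 + k) ^ 2 := by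
    refine Finset.prod_bij' (fun j _ => N - j) (fun k _ => N - k) ?_ ?_ ?_ ?_ ?_
    · intro j hj
      simp only [Finset.mem_Icc] at hj
      simp only [Finset.mem_range]
      omega
    · intro k hk
      simp only [Finset.mem_range] at hk
      simp only [Finset.mem_Icc]
      omega
    · intro j hj
      simp only [Finset.mem_Icc] at hj
      omega
    · intro k hk
      simp only [Finset.mem_range] at hk
      omega
    · intro j hj
      simp only [Finset.mem_Icc] at hj
      rw [Nat.cast_sub hj.2]
      ring_nf
  have h8 : (2 : ℝ) ^ (-(N : ℝ) ^ 2 - 2 * s * N) * 2 ^ N ^ 2 = (2 ^ (-2 * s)) ^ N := by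
    rw [← Real.rpow_natCast 2 (N ^ 2), ← Real.rpow_add (by norm_num),
      ← Real.rpow_natCast (2 ^ (-2 * s)) N, ← Real.rpow_mul (by norm_num)]
    congr 1
    push_cast
    ring
  rw [h1, det_mul_row, det_mul_column, ← RingHom.mapMatrix_apply, ← RingHom.map_det,
    det_Gamma (by linarith), Complex.coe_algebraMap,
    Fin.prod_univ_eq_prod_range b N, Fin.prod_univ_eq_prod_range (fun k => C * a k) N,
    Finset.prod_mul_distrib, Finset.prod_const, Finset.card_range]
  have h9 : (∏ l ∈ Finset.range N, b l) * ((C ^ N * ∏ k ∈ Finset.range N, a k) *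
      (((∏ l ∈ Finset.range N, Real.Gamma (2 * s + 1 + l)) * barnesGSucc N : ℝ) : ℂ)) =
      ((((2 ^ (-2 * s) * π) ^ N * (∏ k ∈ Finset.range N, (1 / 4 : ℝ) ^ k /
        Real.Gamma (s + 1 + k) ^ 2) *
        ((∏ l ∈ Finset.range N, Real.Gamma (2 * s + 1 + l)) * barnesGSucc N) : ℝ)) : ℂ) := by
    have hprod : ((∏ k ∈ Finset.range N, (1 / 4 : ℝ) ^ k / Real.Gamma (s + 1 + k) ^ 2 : ℝ) : ℂ) =
        (∏ k ∈ Finset.range N, a k) * ∏ k ∈ Finset.range N, b k := by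
      rw [Complex.ofReal_prod, ← Finset.prod_mul_distrib]
      exact Finset.prod_congr rfl fun k _ => (h2 k).symm
    rw [Complex.ofReal_mul ((2 ^ (-2 * s) * π) ^ N * _),
      Complex.ofReal_mul ((2 ^ (-2 * s) * π) ^ N),
      hprod, Complex.ofReal_pow, ← hC]
    ring
  rw [h9, huaPickrellConst, h7]
  congr 1
  simp only [Finset.prod_div_distrib]
  have h10 := h4 N
  have h11 : (0 : ℝ) < 2 ^ N ^ 2 := by positivity
  refine mul_right_cancel₀ h11.ne' ?_
  rw [mul_pow, mul_pow, ← h8]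
  linear_combination ((2 : ℝ) ^ (-(N : ℝ) ^ 2 - 2 * s * N) * 2 ^ N ^ 2 * π ^ N *
    (∏ l ∈ Finset.range N, Real.Gamma (2 * s + 1 + l)) * barnesGSucc N /
      ∏ k ∈ Finset.range N, Real.Gamma (s + 1 + k) ^ 2) * h10

/-- The unnormalized Hua–Pickrell density, on all of `ℝ^N` rather than on the Weyl chamber. -/
def huaPickrellWeight (N : ℕ) (s : ℝ) (x : Fin N → ℝ) : ℝ :=
  (∏ j, 1 / (1 + x j ^ 2) ^ ((N : ℝ) + s)) * vandermonde x ^ 2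

theorem huaPickrellWeight_nonneg (N : ℕ) (s : ℝ) (x : Fin N → ℝ) : 0 ≤ huaPickrellWeight N s x := by
  unfold huaPickrellWeight
  exact mul_nonneg (Finset.prod_nonneg fun j _ => by positivity) (sq_nonneg _)

theorem huaPickrellWeight_eq_cauchyWeight {N : ℕ} (hN : 1 ≤ N) (s : ℝ) (x : Fin N → ℝ) :
    huaPickrellWeight N s x =
      (∏ j, cauchyWeight s (x j)) * (vandermonde x ^ 2 / ∏ j, (1 + x j ^ 2) ^ (N - 1)) := by
  have h1 : ∀ j, 1 / (1 + x j ^ 2) ^ ((N : ℝ) + s) =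
      cauchyWeight s (x j) / (1 + x j ^ 2) ^ (N - 1) := by
    intro j
    have hpos : 0 < 1 + x j ^ 2 := by positivity
    rw [cauchyWeight, ← Real.rpow_natCast (1 + x j ^ 2) (N - 1), ← Real.rpow_sub hpos, one_div,
      ← Real.rpow_neg hpos.le,
      Nat.cast_sub hN]
    congr 1
    push_cast
    ring
  rw [huaPickrellWeight, Finset.prod_congr rfl fun j _ => h1 j, Finset.prod_div_distrib]
  ring

/-- The Hua–Pickrell density as a product of two determinants, from
`(x - y)² = (1 + x²) (1 + y²) (u - v) (ū - v̄)` for `u = (x + i)⁻¹`, `v = (y + i)⁻¹`. -/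
theorem ofReal_huaPickrellWeight {N : ℕ} (hN : 1 ≤ N) (s : ℝ) (x : Fin N → ℝ) :
    (huaPickrellWeight N s x : ℂ) =
      (Matrix.of fun k j : Fin N =>
        (cauchyWeight s (x j) : ℂ) * ((x j : ℂ) + Complex.I)⁻¹ ^ (k : ℕ)).det *
      (Matrix.of fun k j : Fin N => ((x j : ℂ) - Complex.I)⁻¹ ^ (k : ℕ)).det := by
  have h1 : (Matrix.of fun k j : Fin N =>
        (cauchyWeight s (x j) : ℂ) * ((x j : ℂ) + Complex.I)⁻¹ ^ (k : ℕ)).det =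
      (∏ j, (cauchyWeight s (x j) : ℂ)) *
        (Matrix.vandermonde fun j => ((x j : ℂ) + Complex.I)⁻¹).det := by
    rw [← det_transpose (Matrix.vandermonde _), ← det_mul_row]
    rfl
  have h2 : (Matrix.of fun k j : Fin N => ((x j : ℂ) - Complex.I)⁻¹ ^ (k : ℕ)).det =
        (Matrix.vandermonde fun j => ((x j : ℂ) - Complex.I)⁻¹).det := by
    rw [← det_transpose]
    rfl
  rw [h1, h2, det_vandermonde, det_vandermonde, mul_assoc,
    ← prod_pairs (fun i j => ((x j : ℂ) + Complex.I)⁻¹ - ((x i : ℂ) + Complex.I)⁻¹),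
    ← prod_pairs (fun i j => ((x j : ℂ) - Complex.I)⁻¹ - ((x i : ℂ) - Complex.I)⁻¹),
    ← Finset.prod_mul_distrib, huaPickrellWeight_eq_cauchyWeight hN, vandermonde,
    ← prod_pairs (fun i j => x j - x i), ← prod_pairs_mul (fun j => 1 + x j ^ 2),
    ← Finset.prod_pow, ← Finset.prod_div_distrib]
  push_cast
  congr 1
  refine Finset.prod_congr rfl fun p _ => ?_
  have ha := ofReal_add_I_ne_zero (x p.1)
  have hb := ofReal_add_I_ne_zero (x p.2)
  have hc := ofReal_sub_I_ne_zero (x p.1)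
  have hd := ofReal_sub_I_ne_zero (x p.2)
  have h3 := ofReal_add_I_mul_sub_I (x p.1)
  have h4 := ofReal_add_I_mul_sub_I (x p.2)
  push_cast at h3 h4
  rw [← h3, ← h4]
  field_simp
  ring

theorem integral_huaPickrellWeight {N : ℕ} (hN : 1 ≤ N) {s : ℝ} (hs : -1 / 2 < s) :
    Integrable (huaPickrellWeight N s) ∧
      ∫ x, huaPickrellWeight N s x = N.factorial * huaPickrellConst N s := by
  have h := integral_det_mul_det
    (fun (k : Fin N) (x : ℝ) => (cauchyWeight s x : ℂ) * ((x : ℂ) + Complex.I)⁻¹ ^ (k : ℕ))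
    (fun (k : Fin N) (x : ℝ) => ((x : ℂ) - Complex.I)⁻¹ ^ (k : ℕ)) fun k l => by
      simpa only [mul_assoc] using integrable_cauchyBeta_integrand hs k l
  simp only [← ofReal_huaPickrellWeight hN, mul_assoc] at h
  change _ ∧ _ = _ * (Matrix.of fun k l : Fin N => cauchyBeta s k l).det at h
  rw [det_cauchyBeta hs, integral_complex_ofReal] at h
  refine ⟨by simpa using h.1.re, ?_⟩
  exact_mod_cast h.2

theorem huaPickrellConst_pos (N : ℕ) {s : ℝ} (hs : -1 / 2 < s) : 0 < huaPickrellConst N s := by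
  unfold huaPickrellConst barnesGSucc
  refine mul_pos (mul_pos (by positivity) ?_) ?_
  · exact Finset.prod_pos fun k _ => by exact_mod_cast k.factorial_pos
  · refine Finset.prod_pos fun j hj => ?_
    have hj2 : (j : ℝ) ≤ N := by exact_mod_cast (Finset.mem_Icc.1 hj).2
    exact div_pos (Real.Gamma_pos_of_pos (by linarith))
      (pow_pos (Real.Gamma_pos_of_pos (by linarith)) 2)

/-! ### Symmetrization over the Weyl chamber -/

theorem measurableSet_weylChamber (N : ℕ) : MeasurableSet (weylChamber N) := by
  have h : weylChamber N = ⋂ i, ⋂ j, ⋂ _ : i ≤ j, {x | x j ≤ x i} := by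
    ext x
    simp [weylChamber, Antitone]
  rw [h]
  refine MeasurableSet.iInter fun i => MeasurableSet.iInter fun j =>
    MeasurableSet.iInter fun _ => ?_
  exact measurableSet_le (measurable_pi_apply j) (measurable_pi_apply i)

theorem exists_perm_antitone {N : ℕ} (x : Fin N → ℝ) :
    ∃ σ : Equiv.Perm (Fin N), Antitone (x ∘ σ) := by
  refine ⟨Tuple.sort fun i => -x i, fun i j hij => ?_⟩
  have h := Tuple.monotone_sort (fun i => -x i) hij
  simpa using h

theorem measurePreserving_comp_perm {N : ℕ} (σ : Equiv.Perm (Fin N)) :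
    MeasurePreserving (fun x : Fin N → ℝ => x ∘ σ) := by
  have h := volume_measurePreserving_piCongrLeft (fun _ : Fin N => ℝ) σ.symm
  have e : (fun x : Fin N → ℝ => x ∘ σ) =
      ⇑(MeasurableEquiv.piCongrLeft (fun _ : Fin N => ℝ) σ.symm) := by
    funext x j
    rw [MeasurableEquiv.coe_piCongrLeft, Equiv.piCongrLeft_apply, eq_rec_constant]
    rfl
  rw [e]
  exact h

/-- A symmetric function vanishing where two coordinates agree has the same integral over each of
the `N!` chambers. -/
theorem lintegral_eq_factorial_mul_weylChamber {N : ℕ} {g : (Fin N → ℝ) → ℝ≥0∞}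
    (hg : Measurable g) (hsymm : ∀ (σ : Equiv.Perm (Fin N)) (x), g (x ∘ σ) = g x)
    (hzero : ∀ x, ¬ Function.Injective x → g x = 0) :
    ∫⁻ x, g x = N.factorial * ∫⁻ x in weylChamber N, g x := by
  have hpt : ∀ x, g x = ∑ σ : Equiv.Perm (Fin N), (weylChamber N).indicator g (x ∘ σ) := by
    intro x
    by_cases hx : Function.Injective x
    · obtain ⟨σ, hσ⟩ := exists_perm_antitone x
      rw [Finset.sum_eq_single σ]
      · rw [Set.indicator_of_mem (show x ∘ σ ∈ weylChamber N from hσ), hsymm]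
      · intro τ _ hτ
        refine Set.indicator_of_notMem (fun hmem => hτ ?_) _
        have h := Tuple.unique_antitone (show Antitone (x ∘ τ) from hmem) hσ
        exact Equiv.ext fun i => hx (congrFun h i)
      · simp
    · rw [hzero x hx, eq_comm, Finset.sum_eq_zero]
      intro σ _
      have h0 : g (x ∘ σ) = 0 := (hsymm σ x).trans (hzero x hx)
      exact Set.indicator_apply_eq_zero.2 fun _ => h0
  have hind : Measurable ((weylChamber N).indicator g) :=
    hg.indicator (measurableSet_weylChamber N)
  have hσm : ∀ σ : Equiv.Perm (Fin N), Measurable fun x : Fin N → ℝ =>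
      (weylChamber N).indicator g (x ∘ σ) := fun σ =>
    hind.comp (measurePreserving_comp_perm σ).measurable
  rw [lintegral_congr hpt, lintegral_finsetSum _ fun σ _ => hσm σ,
    Finset.sum_congr rfl fun σ _ => (measurePreserving_comp_perm σ).lintegral_comp hind,
    Finset.sum_const, Finset.card_univ, Fintype.card_perm, Fintype.card_fin, nsmul_eq_mul,
    lintegral_indicator (measurableSet_weylChamber N)]

theorem vandermonde_sq_comp_perm {N : ℕ} (σ : Equiv.Perm (Fin N)) (x : Fin N → ℝ) :
    vandermonde (x ∘ σ) ^ 2 = vandermonde x ^ 2 := by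
  have h : ∀ y : Fin N → ℝ, vandermonde y = (Matrix.vandermonde y).det := fun y =>
    (det_vandermonde y).symm
  have h1 : Matrix.vandermonde (x ∘ σ) = (Matrix.vandermonde x).submatrix σ id := rfl
  rw [h, h, h1, det_permute, mul_pow]
  rcases Int.units_eq_one_or (Equiv.Perm.sign σ) with h2 | h2 <;> simp [h2]

theorem huaPickrellWeight_comp_perm {N : ℕ} (s : ℝ) (σ : Equiv.Perm (Fin N)) (x : Fin N → ℝ) :
    huaPickrellWeight N s (x ∘ σ) = huaPickrellWeight N s x := by
  rw [huaPickrellWeight, huaPickrellWeight, vandermonde_sq_comp_perm]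
  congr 1
  exact Equiv.prod_comp σ fun j => 1 / (1 + x j ^ 2) ^ ((N : ℝ) + s)

theorem huaPickrellWeight_eq_zero {N : ℕ} (s : ℝ) {x : Fin N → ℝ} (hx : ¬ Function.Injective x) :
    huaPickrellWeight N s x = 0 := by
  have h : vandermonde x = 0 := by
    rw [vandermonde, ← det_vandermonde]
    exact not_not.1 (mt det_vandermonde_ne_zero_iff.1 hx)
  rw [huaPickrellWeight, h]
  simp

theorem measurable_huaPickrellWeight (N : ℕ) (s : ℝ) : Measurable (huaPickrellWeight N s) := by
  unfold huaPickrellWeight vandermonde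
  fun_prop

/-- Integration of symmetric functions against the Hua–Pickrell measure. -/
theorem lintegral_huaPickrell {N : ℕ} {s : ℝ} (hs : -1 / 2 < s) {g : (Fin N → ℝ) → ℝ≥0∞}
    (hg : Measurable g) (hsymm : ∀ (σ : Equiv.Perm (Fin N)) (x), g (x ∘ σ) = g x) :
    ∫⁻ x, ENNReal.ofReal (huaPickrellWeight N s x) * g x =
      ENNReal.ofReal (N.factorial * huaPickrellConst N s) * ∫⁻ x, g x ∂(huaPickrell N s) := by
  have hw : Measurable fun x => ENNReal.ofReal (huaPickrellWeight N s x) :=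
    (measurable_huaPickrellWeight N s).ennreal_ofReal
  have hwg : Measurable fun x => ENNReal.ofReal (huaPickrellWeight N s x) * g x := hw.mul hg
  have hc := huaPickrellConst_pos N hs
  rw [lintegral_eq_factorial_mul_weylChamber hwg
    (fun σ x => by rw [huaPickrellWeight_comp_perm, hsymm])
    (fun x hx => by simp [huaPickrellWeight_eq_zero s hx])]
  have hd : ∀ x, ENNReal.ofReal (1 / huaPickrellConst N s *
      (∏ j, 1 / (1 + x j ^ 2) ^ ((N : ℝ) + s)) * vandermonde x ^ 2) =
      ENNReal.ofReal (1 / huaPickrellConst N s) * ENNReal.ofReal (huaPickrellWeight N s x) := by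
    intro x
    rw [← ENNReal.ofReal_mul (by positivity), huaPickrellWeight, mul_assoc]
  rw [huaPickrell, funext hd, lintegral_withDensity_eq_lintegral_mul _ (hw.const_mul _) hg]
  simp only [Pi.mul_apply, mul_assoc]
  rw [lintegral_const_mul _ hwg, ← mul_assoc, ← ENNReal.ofReal_mul (by positivity),
    mul_assoc, mul_one_div_cancel hc.ne', mul_one, ENNReal.ofReal_natCast]

theorem isProbabilityMeasure_huaPickrell {N : ℕ} (hN : 1 ≤ N) {s : ℝ} (hs : -1 / 2 < s) :
    IsProbabilityMeasure (huaPickrell N s) := by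
  have h := lintegral_huaPickrell (N := N) hs (g := fun _ => 1) measurable_const fun _ _ => rfl
  obtain ⟨h1, h2⟩ := integral_huaPickrellWeight hN hs
  have hc := huaPickrellConst_pos N hs
  have hpos : 0 < N.factorial * huaPickrellConst N s := by positivity
  simp only [mul_one, lintegral_one] at h
  rw [← ofReal_integral_eq_lintegral_ofReal h1
    (Filter.Eventually.of_forall (huaPickrellWeight_nonneg N s)), h2] at h
  refine ⟨?_⟩
  have h3 := (ENNReal.mul_right_inj (ENNReal.ofReal_pos.2 hpos).ne' ENNReal.ofReal_ne_top).1
    ((mul_one _).trans h)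
  exact h3.symm

/-! ### Finiteness of the moments -/

theorem vandermonde_sq_le {N : ℕ} (x : Fin N → ℝ) :
    vandermonde x ^ 2 ≤ ∏ j, (1 + x j ^ 2) ^ (N - 1) := by
  rw [vandermonde, ← prod_pairs (fun i j => x j - x i), ← prod_pairs_mul (fun j => 1 + x j ^ 2),
    ← Finset.prod_pow]
  refine Finset.prod_le_prod (fun p _ => sq_nonneg _) fun p _ => ?_
  nlinarith [sq_nonneg (1 + x p.1 * x p.2)]

theorem huaPickrellWeight_le {N : ℕ} (hN : 1 ≤ N) (s : ℝ) (x : Fin N → ℝ) :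
    huaPickrellWeight N s x ≤ ∏ j, cauchyWeight s (x j) := by
  rw [huaPickrellWeight_eq_cauchyWeight hN]
  refine mul_le_of_le_one_right (Finset.prod_nonneg fun j _ => (cauchyWeight_pos s _).le) ?_
  exact div_le_one_of_le₀ (vandermonde_sq_le x) (Finset.prod_nonneg fun j _ => by positivity)

theorem lintegral_prod_cauchyWeight_lt_top (N : ℕ) {s : ℝ} (hs : -1 / 2 < s) :
    ∫⁻ x : Fin N → ℝ, ENNReal.ofReal (∏ j, cauchyWeight s (x j)) < ∞ :=
  (Integrable.fintype_prod (f := fun (_ : Fin N) x => cauchyWeight s x)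
    fun _ => integrable_cauchyWeight hs).lintegral_lt_top

/-- A sum is dominated by a product of one-variable functions. -/
theorem abs_sum_le_prod {N : ℕ} (x : Fin N → ℝ) : |∑ j, x j| ≤ ∏ j, (1 + |x j|) := by
  have h : ∀ t : Finset (Fin N), 1 + ∑ j ∈ t, |x j| ≤ ∏ j ∈ t, (1 + |x j|) := by
    intro t
    induction t using Finset.induction_on with
    | empty => simp
    | insert a t ha ih =>
      rw [Finset.sum_insert ha, Finset.prod_insert ha]
      have h0 : 0 ≤ ∑ j ∈ t, |x j| := Finset.sum_nonneg fun j _ => abs_nonneg _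
      nlinarith [abs_nonneg (x a)]
  linarith [h Finset.univ, Finset.abs_sum_le_sum_abs x Finset.univ]

theorem abs_sum_rpow_le {N : ℕ} {h : ℝ} (hh : 0 ≤ h) (x : Fin N → ℝ) :
    |∑ j, x j| ^ (2 * h) ≤ (2 ^ h) ^ N * ∏ j, (1 + x j ^ 2) ^ h := by
  have h1 : |∑ j, x j| ^ 2 ≤ ∏ j, (2 * (1 + x j ^ 2)) := by
    refine (pow_le_pow_left₀ (abs_nonneg _) (abs_sum_le_prod x) 2).trans ?_
    rw [← Finset.prod_pow]
    refine Finset.prod_le_prod (fun j _ => by positivity) fun j _ => ?_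
    nlinarith [sq_nonneg (1 - |x j|), sq_abs (x j)]
  rw [Real.rpow_mul (abs_nonneg _), Real.rpow_two]
  refine (Real.rpow_le_rpow (by positivity) h1 hh).trans_eq ?_
  rw [← Real.finsetProd_rpow _ _ fun j _ => by positivity]
  have h2 : ∀ j, (2 * (1 + x j ^ 2)) ^ h = 2 ^ h * (1 + x j ^ 2) ^ h := fun j =>
    Real.mul_rpow zero_le_two (by positivity)
  rw [Finset.prod_congr rfl fun j _ => h2 j, Finset.prod_mul_distrib, Finset.prod_const,
    Finset.card_univ, Fintype.card_fin]

theorem lintegral_moment_lt_top_of_nonneg (N : ℕ) {s h : ℝ} (hh : 0 ≤ h) (hhs : h < s + 1 / 2) :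
    ∫⁻ x : Fin N → ℝ, ENNReal.ofReal (∏ j, cauchyWeight s (x j)) *
      ENNReal.ofReal (|∑ j, x j| ^ (2 * h)) < ∞ := by
  have h1 : ∀ x : Fin N → ℝ, ENNReal.ofReal (∏ j, cauchyWeight s (x j)) *
      ENNReal.ofReal (|∑ j, x j| ^ (2 * h)) ≤
      ENNReal.ofReal ((2 ^ h) ^ N) * ENNReal.ofReal (∏ j, cauchyWeight (s - h) (x j)) := by
    intro x
    have hp : 0 ≤ ∏ j, cauchyWeight s (x j) :=
      Finset.prod_nonneg fun j _ => (cauchyWeight_pos s _).le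
    rw [← ENNReal.ofReal_mul hp, ← ENNReal.ofReal_mul (by positivity)]
    refine ENNReal.ofReal_le_ofReal ?_
    refine (mul_le_mul_of_nonneg_left (abs_sum_rpow_le hh x) hp).trans_eq ?_
    have h2 : ∀ j, cauchyWeight (s - h) (x j) = cauchyWeight s (x j) * (1 + x j ^ 2) ^ h := by
      intro j
      rw [cauchyWeight, cauchyWeight, ← Real.rpow_add (by positivity)]
      congr 1
      ring
    rw [Finset.prod_congr rfl fun j _ => h2 j, Finset.prod_mul_distrib]
    ring
  refine (lintegral_mono h1).trans_lt ?_
  rw [lintegral_const_mul' _ _ ENNReal.ofReal_ne_top]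
  exact ENNReal.mul_lt_top ENNReal.ofReal_lt_top
    (lintegral_prod_cauchyWeight_lt_top N (by linarith))

theorem cauchyWeight_le_one {s : ℝ} (hs : -1 / 2 < s) (x : ℝ) : cauchyWeight s x ≤ 1 :=
  Real.rpow_le_one_of_one_le_of_nonpos (by nlinarith [sq_nonneg x]) (by linarith)

/-- `|u|^{2h}` is bounded by an integrable function plus a constant. -/
theorem exists_integrable_bound {h : ℝ} (hh : -1 / 2 < h) (hneg : h < 0) :
    ∃ φ : ℝ → ℝ≥0∞, Measurable φ ∧ ∫⁻ u, φ u < ∞ ∧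
      ∀ u, ENNReal.ofReal (|u| ^ (2 * h)) ≤ φ u + 1 := by
  set ψ : ℝ → ℝ≥0∞ := (Set.Ioo (0 : ℝ) 1).indicator fun u => ENNReal.ofReal (u ^ (2 * h)) with hψ
  have hm : Measurable ψ :=
    Measurable.indicator (by fun_prop) measurableSet_Ioo
  have hi : ∫⁻ u, ψ u < ∞ := by
    rw [hψ, lintegral_indicator measurableSet_Ioo]
    exact ((intervalIntegral.integrableOn_Ioo_rpow_iff one_pos).2 (by linarith)).lintegral_lt_top
  have hm' : Measurable fun u => ψ (-u) := hm.comp measurable_neg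
  refine ⟨fun u => ψ u + ψ (-u), hm.add hm', ?_, fun u => ?_⟩
  · rw [lintegral_add_left hm, lintegral_neg_eq_self]
    exact ENNReal.add_lt_top.2 ⟨hi, hi⟩
  · rcases le_or_gt 1 |u| with hu | hu
    · have h1 : |u| ^ (2 * h) ≤ 1 := Real.rpow_le_one_of_one_le_of_nonpos hu (by linarith)
      exact (ENNReal.ofReal_le_one.2 h1).trans le_add_self
    · rcases lt_trichotomy u 0 with h0 | h0 | h0
      · rw [abs_of_neg h0] at hu ⊢
        have h1 : ψ (-u) = ENNReal.ofReal ((-u) ^ (2 * h)) :=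
          Set.indicator_of_mem (show -u ∈ Set.Ioo (0 : ℝ) 1 from ⟨by linarith, hu⟩) _
        rw [← h1]
        exact le_add_self.trans le_self_add
      · rw [h0, abs_zero, Real.zero_rpow (by linarith), ENNReal.ofReal_zero]
        exact zero_le
      · rw [abs_of_pos h0] at hu ⊢
        have h1 : ψ u = ENNReal.ofReal (u ^ (2 * h)) :=
          Set.indicator_of_mem (show u ∈ Set.Ioo (0 : ℝ) 1 from ⟨h0, hu⟩) _
        rw [← h1]
        exact le_self_add.trans le_self_add

theorem lintegral_fin_succ (n : ℕ) {F : (Fin (n + 1) → ℝ) → ℝ≥0∞} (hF : Measurable F) :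
    ∫⁻ x, F x = ∫⁻ z : Fin n → ℝ, ∫⁻ y : ℝ, F (Fin.cons y z) := by
  have h := (volume_preserving_piFinSuccAbove (fun _ : Fin (n + 1) => ℝ) 0).symm
  have hm : Measurable fun p : ℝ × (Fin n → ℝ) =>
      F ((MeasurableEquiv.piFinSuccAbove (fun _ : Fin (n + 1) => ℝ) 0).symm p) :=
    hF.comp h.measurable
  rw [← h.lintegral_comp hF, Measure.volume_eq_prod, lintegral_prod_symm _ hm.aemeasurable]
  simp only [MeasurableEquiv.piFinSuccAbove_symm_apply, Fin.insertNthEquiv,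
    Equiv.coe_fn_mk, Fin.insertNth_zero]
  rfl

/-- For a negative exponent the singularity of `|∑ x|^{2h}` is integrated out along one
coordinate, uniformly in the others. -/
theorem lintegral_moment_lt_top_of_neg (n : ℕ) {s h : ℝ} (hs : -1 / 2 < s) (hh : -1 / 2 < h)
    (hneg : h < 0) :
    ∫⁻ x : Fin (n + 1) → ℝ, ENNReal.ofReal (∏ j, cauchyWeight s (x j)) *
      ENNReal.ofReal (|∑ j, x j| ^ (2 * h)) < ∞ := by
  obtain ⟨φ, hφm, hφi, hφ⟩ := exists_integrable_bound hh hneg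
  have hc := continuous_cauchyWeight s
  have hwm : ∀ m : ℕ, Measurable fun x : Fin m → ℝ => ENNReal.ofReal (∏ j, cauchyWeight s (x j)) :=
    fun m => (Continuous.measurable (by fun_prop)).ennreal_ofReal
  have hbound : ∀ x : Fin (n + 1) → ℝ, ENNReal.ofReal (∏ j, cauchyWeight s (x j)) *
      ENNReal.ofReal (|∑ j, x j| ^ (2 * h)) ≤
      ENNReal.ofReal (∏ j : Fin n, cauchyWeight s (x j.succ)) * φ (∑ j, x j) +
        ENNReal.ofReal (∏ j, cauchyWeight s (x j)) := by
    intro x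
    refine (mul_le_mul_right (hφ _) _).trans ?_
    rw [mul_add, mul_one]
    refine add_le_add_left (mul_le_mul_left (ENNReal.ofReal_le_ofReal ?_) _) _
    rw [Fin.prod_univ_succ]
    exact mul_le_of_le_one_left (Finset.prod_nonneg fun j _ => (cauchyWeight_pos s _).le)
      (cauchyWeight_le_one hs _)
  have hφs : Measurable fun x : Fin (n + 1) → ℝ =>
      ENNReal.ofReal (∏ j : Fin n, cauchyWeight s (x j.succ)) * φ (∑ j, x j) := by
    refine Measurable.mul (f := fun x : Fin (n + 1) → ℝ =>
      ENNReal.ofReal (∏ j : Fin n, cauchyWeight s (x j.succ))) ?_ ?_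
    · exact (Continuous.measurable (by fun_prop)).ennreal_ofReal
    · exact hφm.comp (by fun_prop)
  refine (lintegral_mono hbound).trans_lt ?_
  rw [lintegral_add_right _ (hwm _), lintegral_fin_succ n hφs]
  refine ENNReal.add_lt_top.2 ⟨?_, lintegral_prod_cauchyWeight_lt_top _ hs⟩
  have hinner : ∀ z : Fin n → ℝ, ∫⁻ y : ℝ, ENNReal.ofReal (∏ j : Fin n,
      cauchyWeight s ((Fin.cons y z : Fin (n + 1) → ℝ) j.succ)) *
        φ (∑ j, (Fin.cons y z : Fin (n + 1) → ℝ) j) =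
      ENNReal.ofReal (∏ j, cauchyWeight s (z j)) * ∫⁻ u, φ u := by
    intro z
    simp only [Fin.cons_succ, Fin.sum_univ_succ, Fin.cons_zero]
    rw [lintegral_const_mul' _ _ ENNReal.ofReal_ne_top, lintegral_add_right_eq_self φ]
  rw [lintegral_congr hinner, lintegral_mul_const _ (hwm n)]
  exact ENNReal.mul_lt_top (lintegral_prod_cauchyWeight_lt_top n hs) hφi

theorem lintegral_huaPickrellWeight_moment_lt_top {N : ℕ} (hN : 1 ≤ N) {s h : ℝ}
    (hs : -1 / 2 < s) (hh : -1 / 2 < h) (hhs : h < s + 1 / 2) :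
    ∫⁻ x : Fin N → ℝ, ENNReal.ofReal (huaPickrellWeight N s x) *
      ENNReal.ofReal (|∑ j, x j| ^ (2 * h)) < ∞ := by
  refine (lintegral_mono fun x => mul_le_mul_left
    (ENNReal.ofReal_le_ofReal (huaPickrellWeight_le hN s x)) _).trans_lt ?_
  rcases le_or_gt 0 h with h0 | h0
  · exact lintegral_moment_lt_top_of_nonneg N h0 hhs
  · obtain ⟨n, rfl⟩ : ∃ n, N = n + 1 := ⟨N - 1, by omega⟩
    exact lintegral_moment_lt_top_of_neg n hs hh h0

/-! ### The transfer to the Hua–Pickrell measure -/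

/-- In Cayley coordinates the Weyl density times the joint integrand is the Hua–Pickrell weight
times `|∑ x|^{2h}`, up to a constant. -/
theorem cayley_pullback_jointIntegrand {N : ℕ} (hN : 1 ≤ N) (s h : ℝ) (x : Fin N → ℝ) :
    (∏ j, cayleyDensity (x j)) *
      (weylDensityReal (cayleyTorus x) * jointIntegrand N s h (diagU (cayleyTorus x))) =
    (2 ^ N * 4 ^ (pairs N).card * 2 ^ (2 * s * N) * (2 : ℝ) ^ (-2 * h)) *
      (huaPickrellWeight N s x * |∑ j, x j| ^ (2 * h)) := by
  have h1 : ∀ j, cauchyWeight s (x j) = (1 / (1 + x j ^ 2)) * (1 / (1 + x j ^ 2) ^ s) := by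
    intro j
    have hpos : 0 < 1 + x j ^ 2 := by positivity
    rw [cauchyWeight, neg_add, add_comm (-s), Real.rpow_add hpos, Real.rpow_neg hpos.le,
      Real.rpow_neg hpos.le, Real.rpow_one, one_div, one_div]
  have h2 : ∏ j, cayleyDensity (x j) = 2 ^ N * ∏ j, (1 / (1 + x j ^ 2)) := by
    have h3 : ∀ j, cayleyDensity (x j) = 2 * (1 / (1 + x j ^ 2)) := fun j => by
      rw [cayleyDensity]; ring
    rw [Finset.prod_congr rfl fun j _ => h3 j, Finset.prod_mul_distrib, Finset.prod_const,
      Finset.card_univ, Fintype.card_fin]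
  rw [huaPickrellWeight_eq_cauchyWeight hN, Finset.prod_congr rfl fun j _ => h1 j,
    Finset.prod_mul_distrib, h2, weylDensityReal_cayleyTorus, jointIntegrand_cayley]
  ring

theorem weylMeasure_mul_lintegral_jointIntegrand {N : ℕ} (hN : 1 ≤ N) {s : ℝ} (hs : -1 / 2 < s)
    (h : ℝ) :
    weylMeasure N Set.univ * ∫⁻ A, ENNReal.ofReal (jointIntegrand N s h A) ∂(haarU N) =
      ENNReal.ofReal (2 ^ N * 4 ^ (pairs N).card * 2 ^ (2 * s * N) * (2 : ℝ) ^ (-2 * h)) *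
        (ENNReal.ofReal (N.factorial * huaPickrellConst N s) *
          ∫⁻ x : Fin N → ℝ, ENNReal.ofReal (|∑ j, x j| ^ (2 * h)) ∂(huaPickrell N s)) := by
  have hF : Measurable fun A : U N => ENNReal.ofReal (jointIntegrand N s h A) :=
    (measurable_jointIntegrand s h).ennreal_ofReal
  have hg : Measurable fun θ : Torus N =>
      ENNReal.ofReal (weylDensityReal θ) * ENNReal.ofReal (jointIntegrand N s h (diagU θ)) :=
    continuous_weylDensityReal.measurable.ennreal_ofReal.mul
      (hF.comp continuous_diagU.measurable)
  have hq : Measurable fun x : Fin N → ℝ => ENNReal.ofReal (|∑ j, x j| ^ (2 * h)) := by fun_prop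
  rw [lintegral_haarU_of_conj_invariant hF fun W A => by rw [jointIntegrand_conj],
    lintegral_torus_eq hg, ← lintegral_huaPickrell hs hq
      fun σ x => by rw [show ∑ j, (x ∘ σ) j = ∑ j, x j from Equiv.sum_comp σ x],
    ← lintegral_const_mul' _ _ ENNReal.ofReal_ne_top]
  refine lintegral_congr fun x => ?_
  have hd : 0 ≤ ∏ j, cayleyDensity (x j) := Finset.prod_nonneg fun j _ => (cayleyDensity_pos _).le
  rw [← ENNReal.ofReal_mul' (jointIntegrand_nonneg s h _), ← ENNReal.ofReal_mul hd,
    ← ENNReal.ofReal_mul (huaPickrellWeight_nonneg N s x), ← ENNReal.ofReal_mul (by positivity),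
    cayley_pullback_jointIntegrand hN]

/-- The constant in Weyl's integration formula is nonzero, as the case `s = h = 0` shows. -/
theorem weylMeasure_univ_ne_zero {N : ℕ} (hN : 1 ≤ N) : weylMeasure N Set.univ ≠ 0 := by
  intro h0
  have h := weylMeasure_mul_lintegral_jointIntegrand hN (s := 0) (by norm_num) 0
  have := isProbabilityMeasure_huaPickrell hN (s := 0) (by norm_num)
  have hc := huaPickrellConst_pos N (s := 0) (by norm_num)
  rw [h0, zero_mul] at h
  simp only [mul_zero, Real.rpow_zero, ENNReal.ofReal_one, lintegral_one, measure_univ,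
    mul_one] at h
  rw [← ENNReal.ofReal_mul (by positivity), eq_comm, ENNReal.ofReal_eq_zero] at h
  have : 0 < (2 : ℝ) ^ N * 4 ^ (pairs N).card * 2 ^ (0 * (N : ℝ)) *
    (N.factorial * huaPickrellConst N 0) := by positivity
  simp only [zero_mul, Real.rpow_zero, mul_one] at h this
  linarith

theorem lintegral_moment_huaPickrell_lt_top {N : ℕ} (hN : 1 ≤ N) {s h : ℝ}
    (hs : -1 / 2 < s) (hh : -1 / 2 < h) (hhs : h < s + 1 / 2) :
    ∫⁻ x : Fin N → ℝ, ENNReal.ofReal (|∑ j, x j| ^ (2 * h)) ∂(huaPickrell N s) < ∞ := by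
  have hq : Measurable fun x : Fin N → ℝ => ENNReal.ofReal (|∑ j, x j| ^ (2 * h)) := by fun_prop
  have h1 := lintegral_huaPickrellWeight_moment_lt_top hN hs hh hhs
  have hc := huaPickrellConst_pos N hs
  rw [lintegral_huaPickrell hs hq
    fun σ x => by rw [show ∑ j, (x ∘ σ) j = ∑ j, x j from Equiv.sum_comp σ x]] at h1
  refine ENNReal.lt_top_of_mul_ne_top_right h1.ne (ENNReal.ofReal_pos.2 ?_).ne'
  positivity

/-- Dividing the transfer formula by its case `h = 0` eliminates the constants. -/
theorem lintegral_jointIntegrand {N : ℕ} (hN : 1 ≤ N) {s : ℝ} (hs : -1 / 2 < s) (h : ℝ) :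
    ∫⁻ A, ENNReal.ofReal (jointIntegrand N s h A) ∂(haarU N) =
      (∫⁻ A, ENNReal.ofReal (jointIntegrand N s 0 A) ∂(haarU N)) *
        ENNReal.ofReal ((2 : ℝ) ^ (-2 * h)) *
        ∫⁻ x : Fin N → ℝ, ENNReal.ofReal (|∑ j, x j| ^ (2 * h)) ∂(huaPickrell N s) := by
  have := isProbabilityMeasure_huaPickrell hN hs
  have h0 := weylMeasure_mul_lintegral_jointIntegrand hN hs 0
  have h1 := weylMeasure_mul_lintegral_jointIntegrand hN hs h
  simp only [mul_zero, Real.rpow_zero, ENNReal.ofReal_one, lintegral_one, measure_univ,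
    mul_one] at h0
  refine (ENNReal.mul_right_inj (weylMeasure_univ_ne_zero hN)
    (measure_ne_top (weylMeasure N) Set.univ)).1 ?_
  rw [h1, ← mul_assoc, ← mul_assoc, ← mul_assoc, h0, ENNReal.ofReal_mul (by positivity)]
  ring

theorem lintegral_jointIntegrand_lt_top {N : ℕ} (hN : 1 ≤ N) {s h : ℝ}
    (hs : -1 / 2 < s) (hh : -1 / 2 < h) (hhs : h < s + 1 / 2) :
    ∫⁻ A, ENNReal.ofReal (jointIntegrand N s h A) ∂(haarU N) < ∞ := by
  have h1 := weylMeasure_mul_lintegral_jointIntegrand hN hs h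
  refine ENNReal.lt_top_of_mul_ne_top_right (h1.trans_ne ?_) (weylMeasure_univ_ne_zero hN)
  exact ENNReal.mul_ne_top ENNReal.ofReal_ne_top (ENNReal.mul_ne_top ENNReal.ofReal_ne_top
    (lintegral_moment_huaPickrell_lt_top hN hs hh hhs).ne)

end JointMoments

end

theorem proposition2p5 (N : ℕ) (hN : 1 ≤ N) (s h : ℝ) (hs : -1 / 2 < s)
    (hh : -1 / 2 < h) (hhs : h < s + 1 / 2) :
    MeasureTheory.IsProbabilityMeasure (JointMoments.huaPickrell N s) ∧
    MeasureTheory.Integrable (JointMoments.jointIntegrand N s h) (JointMoments.haarU N) ∧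
    MeasureTheory.Integrable (fun x : Fin N → ℝ => |∑ i, x i| ^ (2 * h))
      (JointMoments.huaPickrell N s) ∧
    JointMoments.jointMoment N s h =
      JointMoments.jointMoment N s 0 * (2 : ℝ) ^ (-2 * h) *
        ∫ x : Fin N → ℝ, |∑ i, x i| ^ (2 * h) ∂(JointMoments.huaPickrell N s) := by
  have hm : ∀ h' : ℝ, MeasureTheory.AEStronglyMeasurable (JointMoments.jointIntegrand N s h')
      (JointMoments.haarU N) := fun h' =>
    (JointMoments.measurable_jointIntegrand s h').aestronglyMeasurable
  have hnn : ∀ h' : ℝ, 0 ≤ᵐ[JointMoments.haarU N] JointMoments.jointIntegrand N s h' := fun h' =>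
    Filter.Eventually.of_forall (JointMoments.jointIntegrand_nonneg s h')
  have hqm : MeasureTheory.AEStronglyMeasurable (fun x : Fin N → ℝ => |∑ i, x i| ^ (2 * h))
      (JointMoments.huaPickrell N s) := Measurable.aestronglyMeasurable (by fun_prop)
  have hqn : 0 ≤ᵐ[JointMoments.huaPickrell N s] fun x : Fin N → ℝ => |∑ i, x i| ^ (2 * h) :=
    Filter.Eventually.of_forall fun x => Real.rpow_nonneg (abs_nonneg _) _
  refine ⟨JointMoments.isProbabilityMeasure_huaPickrell hN hs,
    (MeasureTheory.lintegral_ofReal_ne_top_iff_integrable (hm h) (hnn h)).1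
      (JointMoments.lintegral_jointIntegrand_lt_top hN hs hh hhs).ne,
    (MeasureTheory.lintegral_ofReal_ne_top_iff_integrable hqm hqn).1
      (JointMoments.lintegral_moment_huaPickrell_lt_top hN hs hh hhs).ne, ?_⟩
  rw [JointMoments.jointMoment, JointMoments.jointMoment,
    MeasureTheory.integral_eq_lintegral_of_nonneg_ae (hnn h) (hm h),
    MeasureTheory.integral_eq_lintegral_of_nonneg_ae (hnn 0) (hm 0),
    MeasureTheory.integral_eq_lintegral_of_nonneg_ae hqn hqm,
    JointMoments.lintegral_jointIntegrand hN hs h, ENNReal.toReal_mul, ENNReal.toReal_mul,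
    ENNReal.toReal_ofReal (Real.rpow_nonneg zero_le_two _)]
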